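/- Let $q\ge 3$ be a prime power, let $\mathbb F_q$ be the field with $q$ elements, and let $n\ge 1$. For $X\in M_n(\mathbb F_q)$ regard the row space $V=\mathbb F_q^{1\times n}$ as an $\mathbb F_q[t]$-module with $t$ acting as right multiplication by $X$, and let $c_X(t)$ be the characteristic polynomial of $X$. For a monic irreducible polynomial $g$ of multiplicity $\nu(g)$ in $c_X$, the $g$-primary component of $V$ is $V(g)=\ker g(X)^{\nu(g)}$. The matrix $X$ is called $f$-cyclic if $V(g)$ is a cyclic $\mathbb F_q[t]$-module for at least one monic irreducible divisor $g$ of $c_X$. Then the probability $p$ that a uniformly distributed random matrix in $M_n(\mathbb F_q)$ is $f$-cyclic satisfies \[ 1-k(q)\,q^{-1}\left(q^{-1}+q^{-2}+\tfrac{12}{5}q^{-3}\right)^n < p \le 1, \qquad\text{where } k(q)=1+\tfrac32 q^{-1}+\tfrac23 q^{-2}. \] -/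

import Mathlib

open Polynomial

/-- The vector space `F^{1 × n}` of row vectors, viewed as an `F[t]`-module on which `t` acts as
right multiplication by the matrix `X`. -/
abbrev RowModule {F : Type*} [Field F] {n : ℕ} (X : Matrix (Fin n) (Fin n) F) : Type _ :=
  Module.AEval' X.vecMulLinear

/-- The `g`-primary component `V(g) = ker g(X)^ν` of the row space of `X`, as an `F[t]`-submodule,
where `ν` is the multiplicity of `g` in the characteristic polynomial of `X`. -/
noncomputable def primaryComponent {F : Type*} [Field F] {n : ℕ}
    (X : Matrix (Fin n) (Fin n) F) (g : F[X]) : Submodule F[X] (RowModule X) :=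
  Submodule.torsionBy F[X] (RowModule X) (g ^ multiplicity g X.charpoly)

/-- `X` is `f`-cyclic relative to `g` if its `g`-primary component is a cyclic `F[t]`-module. -/
def IsFCyclicRel {F : Type*} [Field F] {n : ℕ}
    (X : Matrix (Fin n) (Fin n) F) (g : F[X]) : Prop :=
  (primaryComponent X g).IsPrincipal

/-- `X` is `f`-cyclic if it is `f`-cyclic relative to some monic irreducible divisor of its
characteristic polynomial. -/
def IsFCyclic {F : Type*} [Field F] {n : ℕ} (X : Matrix (Fin n) (Fin n) F) : Prop :=
  ∃ g : F[X], g.Monic ∧ Irreducible g ∧ g ∣ X.charpoly ∧ IsFCyclicRel X g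

/-- The probability that a uniformly distributed random `n × n` matrix over the finite field `F`
is `f`-cyclic. -/
noncomputable def fCyclicProb (F : Type*) [Field F] [Fintype F] (n : ℕ) : ℝ :=
  letI : MeasurableSpace (Matrix (Fin n) (Fin n) F) := ⊤
  (PMF.uniformOfFintype (Matrix (Fin n) (Fin n) F)).toMeasure.real {X | IsFCyclic X}

open Module

/-! ### Cyclic submodules generated by a vector -/

section Orbits

variable {F V W : Type*} [Field F] [AddCommGroup V] [Module F V] [AddCommGroup W] [Module F W]

/-! Write x = 1/q. A matrix that is not f-cyclic has no nonzero cyclic primary component; let U_n be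
the number of such endomorphisms of F^n divided by |GL_n|. Since |GL_n| ≤ q^(n²), 1 - p ≤ U_n, so it
suffices to bound U_n. Normalising by |GL_n| instead of q^(n²) makes counts multiplicative under
direct sums: splitting off one primary component of dimension m gives the renewal inequality U_n ≤ ∑
A_m U_(n-m), where A_m is the normalised count of noncyclic endomorphisms with a single primary
component (`uncyclicCard_div_le`). Only upper bounds are needed, so no exact cycle index appears.

To bound A_m, fix g of degree d and put X = x^d. Counting pairs (f, v) with f g-primary and v ≠ 0,
according to the cyclic submodule generated by v, yields a recursion whose solution bounds the
normalised number of g-primary endomorphisms of F^(rd) by X^r / ∏_{i≤r} (1 - X^i)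
(`primaryCard_div_glCard_le`). The cyclic ones contribute at least X^r / (1 - X), because each has
at most X^(-r) - X^(-(r-1)) generators (`glCard_le_card_cyclicSet_mul`). The difference is
O(X^(r+2)); summing over the at most q^d polynomials of each degree gives A_m = O(x^(m+1)), with d =
1 dominant, and A_1 = 0.

Finally `lt_of_renewal` turns the renewal inequality into U_n < k x (xρ)^n with ρ = 1 + x + (12/5)
x², by induction, provided the constants satisfy `rate_inequality`. -/

theorem map_aeval_apply_of_semiconj {f : End F V} {f' : End F W} (φ : V →ₗ[F] W)
    (h : ∀ x, φ (f x) = f' (φ x)) (p : F[X]) (x : V) :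
    φ (aeval f p x) = aeval f' p (φ x) := by
  induction p using Polynomial.induction_on' generalizing x with
  | add p q hp hq => simp [hp, hq]
  | monomial n a =>
    have : ∀ y, φ ((f ^ n) y) = (f' ^ n) (φ y) := by
      induction n with
      | zero => simp
      | succ n ih => intro y; rw [pow_succ, pow_succ, Module.End.mul_apply, Module.End.mul_apply,
          ih, h]
    simp [aeval_monomial, this, Module.algebraMap_end_eq_smul_id]

theorem isNilpotent_aeval_of_surjective {f : End F V} {f' : End F W} (φ : V →ₗ[F] W)
    (h : ∀ x, φ (f x) = f' (φ x)) (hφ : Function.Surjective φ) {p : F[X]}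
    (hf : IsNilpotent (aeval f p)) : IsNilpotent (aeval f' p) := by
  obtain ⟨N, hN⟩ := hf
  refine ⟨N, LinearMap.ext fun y => ?_⟩
  obtain ⟨x, rfl⟩ := hφ y
  rw [← map_pow, ← map_aeval_apply_of_semiconj φ h, map_pow, hN]
  simp

/-- Multiplication by the root of `p` on `F[t]/(p)`. -/
noncomputable def rootMul (p : F[X]) : End F (AdjoinRoot p) :=
  Algebra.lmul F (AdjoinRoot p) (AdjoinRoot.root p)

theorem aeval_rootMul_apply (p s : F[X]) (x : AdjoinRoot p) :
    aeval (rootMul p) s x = AdjoinRoot.mk p s * x := by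
  rw [rootMul, aeval_algHom_apply, AdjoinRoot.aeval_eq]
  rfl

/-- The map `s ↦ s(f) v` from `F[t]/(p)`, meaningful when `p(f) v = 0`. -/
noncomputable def orbitMap {p : F[X]} (hp : p.Monic) (f : End F V) (v : V) :
    AdjoinRoot p →ₗ[F] V :=
  (LinearMap.applyₗ v).comp ((aeval f).toLinearMap.comp (AdjoinRoot.modByMonicHom hp))

theorem orbitMap_mk {p : F[X]} (hp : p.Monic) {f : End F V} {v : V} (hv : aeval f p v = 0)
    (s : F[X]) : orbitMap hp f v (AdjoinRoot.mk p s) = aeval f s v := by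
  have h : orbitMap hp f v (AdjoinRoot.mk p s) = aeval f (s %ₘ p) v := by
    simp [orbitMap, AdjoinRoot.modByMonicHom_mk]
  rw [h]
  conv_rhs => rw [← modByMonic_add_div s p]
  simp [mul_comm p, hv]

theorem orbitMap_rootMul {p : F[X]} (hp : p.Monic) {f : End F V} {v : V}
    (hv : aeval f p v = 0) (x : AdjoinRoot p) :
    orbitMap hp f v (rootMul p x) = f (orbitMap hp f v x) := by
  obtain ⟨s, rfl⟩ := AdjoinRoot.mk_surjective x
  have : rootMul p (AdjoinRoot.mk p s) = AdjoinRoot.mk p (X * s) := by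
    rw [map_mul, AdjoinRoot.mk_X]; rfl
  rw [this, orbitMap_mk hp hv, orbitMap_mk hp hv]
  simp

/-- If s kills v, so does gcd(s, g^(k+1)) by Bézout. That gcd is associated to a power of g, and no
power below the (k+1)-st kills v. -/
theorem orbitMap_injective {g : F[X]} (hi : Irreducible g) {k : ℕ}
    (hp : (g ^ (k + 1)).Monic) {f : End F V} {v : V} (hv : aeval f (g ^ (k + 1)) v = 0)
    (hv' : aeval f (g ^ k) v ≠ 0) : Function.Injective (orbitMap hp f v) := by
  classical
  rw [injective_iff_map_eq_zero]
  intro x hx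
  obtain ⟨s, rfl⟩ := AdjoinRoot.mk_surjective x
  rw [orbitMap_mk hp hv] at hx
  rw [AdjoinRoot.mk_eq_zero]
  have h1 : aeval f (EuclideanDomain.gcd s (g ^ (k + 1))) v = 0 := by
    rw [EuclideanDomain.gcd_eq_gcd_ab s (g ^ (k + 1)), mul_comm s, mul_comm (g ^ (k + 1)), map_add,
      map_mul, map_mul]
    simp only [LinearMap.add_apply, Module.End.mul_apply, hx, hv, map_zero, add_zero]
  obtain ⟨i, hik, hi'⟩ := (dvd_prime_pow hi.prime _).1 (EuclideanDomain.gcd_dvd_right s (g ^ (k + 1)))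
  rcases Nat.lt_or_ge i (k + 1) with h | h
  · exfalso
    apply hv'
    obtain ⟨c, hc⟩ : EuclideanDomain.gcd s (g ^ (k + 1)) ∣ g ^ k :=
      hi'.dvd.trans (pow_dvd_pow g (Nat.lt_succ_iff.1 h))
    rw [hc, mul_comm, map_mul, Module.End.mul_apply, h1, map_zero]
  · obtain rfl : i = k + 1 := le_antisymm hik h
    exact hi'.symm.dvd.trans (EuclideanDomain.gcd_dvd_left s _)

theorem finrank_adjoinRoot {p : F[X]} (hp : p ≠ 0) :
    finrank F (AdjoinRoot p) = p.natDegree :=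
  (AdjoinRoot.powerBasis hp).finrank

/-- A nonzero vector splits off the cyclic submodule it generates as a diagonal block. -/
theorem exists_block_decomposition [FiniteDimensional F V] {g : F[X]} (hm : g.Monic)
    (hi : Irreducible g) {f : End F V} (hf : IsNilpotent (aeval f g)) {v : V} (hv : v ≠ 0) :
    ∃ k b, 1 ≤ k ∧ b + k * g.natDegree = finrank F V ∧
      ∃ (φ : ((Fin b → F) × AdjoinRoot (g ^ k)) ≃ₗ[F] V) (Y : End F (Fin b → F))
        (B : (Fin b → F) →ₗ[F] AdjoinRoot (g ^ k)),
        IsNilpotent (aeval Y g) ∧ φ (0, 1) = v ∧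
          ∀ w a, f (φ (w, a)) = φ (Y w, rootMul (g ^ k) a + B w) := by
  classical
  obtain ⟨N, hN⟩ := hf
  have hex : ∃ k, aeval f (g ^ k) v = 0 := ⟨N, by rw [map_pow, hN]; simp⟩
  -- The annihilator of v is generated by g^(k+1); the exponent is positive because v ≠ 0.
  obtain ⟨k, hk, hkmin⟩ : ∃ k, aeval f (g ^ (k + 1)) v = 0 ∧ aeval f (g ^ k) v ≠ 0 := by
    have h0 : Nat.find hex ≠ 0 := by
      intro h
      have := Nat.find_spec hex
      rw [h] at this
      simp at this
      exact hv this
    obtain ⟨k, hk⟩ := Nat.exists_eq_succ_of_ne_zero h0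
    exact ⟨k, by have := Nat.find_spec hex; rwa [hk] at this, Nat.find_min hex (by omega)⟩
  have hp : (g ^ (k + 1)).Monic := hm.pow _
  set ι := orbitMap hp f v with hι
  have hinj : Function.Injective ι := orbitMap_injective hi hp hk hkmin
  -- U is only a vector space complement, not f-stable, so f becomes block triangular: Y is the map
  -- induced on the quotient by the orbit of v, and B is the off-diagonal block.
  obtain ⟨U, hU⟩ := Submodule.exists_isCompl (LinearMap.range ι)
  let eU : (Fin (finrank F U) → F) ≃ₗ[F] U := (finBasis F U).equivFun.symm
  let φ : ((Fin (finrank F U) → F) × AdjoinRoot (g ^ (k + 1))) ≃ₗ[F] V :=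
    (eU.prodCongr (LinearEquiv.ofInjective ι hinj)).trans (Submodule.prodEquivOfIsCompl _ _ hU.symm)
  have hφ : ∀ w a, φ (w, a) = eU w + ι a := fun w a => by
    simp [φ, Submodule.coe_prodEquivOfIsCompl']
  have hfa : ∀ a, f (φ (0, a)) = φ (0, rootMul (g ^ (k + 1)) a) := fun a => by
    simp [hφ, hι, orbitMap_rootMul hp hk]
  let Y : End F (Fin (finrank F U) → F) :=
    (LinearMap.fst F _ _) ∘ₗ φ.symm.toLinearMap ∘ₗ f ∘ₗ φ.toLinearMap ∘ₗ LinearMap.inl F _ _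
  let B : (Fin (finrank F U) → F) →ₗ[F] AdjoinRoot (g ^ (k + 1)) :=
    (LinearMap.snd F _ _) ∘ₗ φ.symm.toLinearMap ∘ₗ f ∘ₗ φ.toLinearMap ∘ₗ LinearMap.inl F _ _
  have hblk : ∀ w a, f (φ (w, a)) = φ (Y w, rootMul (g ^ (k + 1)) a + B w) := by
    intro w a
    have h1 : ((w, a) : (Fin (finrank F U) → F) × AdjoinRoot (g ^ (k + 1))) = (w, 0) + (0, a) := by
      simp
    have h2 : (Y w, rootMul (g ^ (k + 1)) a + B w) = (Y w, B w) + (0, rootMul (g ^ (k + 1)) a) := by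
      simp [add_comm]
    rw [h1, h2, map_add, map_add, map_add, hfa]
    congr 1
    rw [← φ.symm_apply_eq]
    rfl
  refine ⟨k + 1, finrank F U, by omega, ?_, φ, Y, B, ?_, ?_, hblk⟩
  · have h1 := φ.finrank_eq
    have : Module.Finite F (AdjoinRoot (g ^ (k + 1))) := hp.finite_adjoinRoot
    rw [finrank_prod, finrank_adjoinRoot hp.ne_zero, natDegree_pow] at h1
    simpa using h1
  · let π : V →ₗ[F] (Fin (finrank F U) → F) := LinearMap.fst F _ _ ∘ₗ φ.symm.toLinearMap
    have hπ : ∀ x, π (f x) = Y (π x) := by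
      intro x
      obtain ⟨⟨w, a⟩, rfl⟩ := φ.surjective x
      rw [hblk]
      simp [π]
    exact isNilpotent_aeval_of_surjective π hπ (fun w => ⟨φ (w, 0), by simp [π]⟩) ⟨N, hN⟩
  · rw [hφ, map_zero]
    have : (1 : AdjoinRoot (g ^ (k + 1))) = AdjoinRoot.mk _ 1 := by simp
    rw [this, hι, orbitMap_mk hp hk]
    simp

end Orbits

/-! ### Double counting over frames and the order of GL_n -/

section Counting

/-- A double counting principle: if every `s : S` can be recovered from each `act φ h` (for a
suitable `φ` depending on `s`) together with some `d : D`, then `|S| |H| ≤ |Φ| |D|`. -/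
theorem card_mul_card_le_of_action {S T H Φ D : Type*} [Finite Φ] [Finite D] (ι : S → T)
    (hι : Function.Injective ι) (act : Φ → H → Φ) (hact : ∀ φ, Function.Injective (act φ))
    (recover : Φ → D → T) (h : ∀ s, ∃ φ, ∀ x, ∃ d, recover (act φ x) d = ι s) :
    Nat.card S * Nat.card H ≤ Nat.card Φ * Nat.card D := by
  choose c hc using h
  choose d hd using hc
  rw [← Nat.card_prod, ← Nat.card_prod]
  refine Nat.card_le_card_of_injective (fun p : S × H => (act (c p.1) p.2, d p.1 p.2)) ?_
  rintro ⟨s, x⟩ ⟨s', x'⟩ hp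
  obtain ⟨h1, h2⟩ := Prod.ext_iff.1 hp
  simp only at h1 h2
  obtain rfl : s = s' := hι (by rw [← hd s x, ← hd s' x', h1, h2])
  rw [hact _ h1]

variable (F : Type*) [Field F]

/-- The order of `GL_n(F)`. -/
noncomputable def glCard (n : ℕ) : ℕ := Nat.card ((Fin n → F) ≃ₗ[F] (Fin n → F))

variable {F}

theorem finite_linearMap [Finite F] (V W : Type*) [AddCommGroup V] [Module F V] [AddCommGroup W]
    [Module F W] [FiniteDimensional F V] [FiniteDimensional F W] : Finite (V →ₗ[F] W) := by
  have := Module.finite_of_finite F (M := V)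
  have := Module.finite_of_finite F (M := W)
  exact DFunLike.finite _

theorem finite_linearEquiv [Finite F] (V W : Type*) [AddCommGroup V] [Module F V] [AddCommGroup W]
    [Module F W] [FiniteDimensional F V] [FiniteDimensional F W] : Finite (V ≃ₗ[F] W) := by
  have := Module.finite_of_finite F (M := V)
  have := Module.finite_of_finite F (M := W)
  exact DFunLike.finite _

theorem card_linearEquiv {V W : Type*} [AddCommGroup V] [Module F V] [AddCommGroup W]
    [Module F W] [FiniteDimensional F V] [FiniteDimensional F W] {n : ℕ}
    (hV : finrank F V = n) (hW : finrank F W = n) : Nat.card (V ≃ₗ[F] W) = glCard F n := by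
  let eV : V ≃ₗ[F] (Fin n → F) := LinearEquiv.ofFinrankEq _ _ (by simpa using hV)
  let eW : W ≃ₗ[F] (Fin n → F) := LinearEquiv.ofFinrankEq _ _ (by simpa using hW)
  exact Nat.card_congr
    { toFun := fun φ => (eV.symm.trans φ).trans eW
      invFun := fun ψ => (eV.trans ψ).trans eW.symm
      left_inv := fun φ => by ext; simp
      right_inv := fun ψ => by ext; simp }

theorem glCard_pos [Finite F] (n : ℕ) : 0 < glCard F n := by
  have := finite_linearEquiv (F := F) (Fin n → F) (Fin n → F)
  have : Nonempty ((Fin n → F) ≃ₗ[F] (Fin n → F)) := ⟨LinearEquiv.refl _ _⟩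
  exact Nat.card_pos

theorem glCard_zero : glCard F 0 = 1 := by
  rw [glCard, Nat.card_eq_one_iff_unique]
  exact ⟨⟨fun a b => by ext x i; exact i.elim0⟩, ⟨LinearEquiv.refl _ _⟩⟩

theorem card_end [Finite F] (n : ℕ) : Nat.card (End F (Fin n → F)) = Nat.card F ^ n ^ 2 := by
  rw [Nat.card_congr (LinearMap.toMatrix' (R := F) (m := Fin n) (n := Fin n)).toEquiv]
  simp [Matrix, Nat.card_fun, ← pow_mul, sq]

theorem glCard_le [Finite F] (n : ℕ) : glCard F n ≤ Nat.card F ^ n ^ 2 := by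
  have := finite_linearMap (F := F) (Fin n → F) (Fin n → F)
  rw [← card_end]
  exact Nat.card_le_card_of_injective _ LinearEquiv.toLinearMap_injective

/-- The number of endomorphisms `f` of `F^n` with `g(f)` nilpotent. -/
noncomputable def primaryCard (g : F[X]) (n : ℕ) : ℕ :=
  Nat.card {f : End F (Fin n → F) // IsNilpotent (aeval f g)}

/-- The pairs `(f, v)` such that `f` is block triangular, one block being multiplication by `t` on
`F[t]/(g^k)` with `v` corresponding to `1`, the other block `Y` of size `b` being
`g`-primary. -/
def blockPairs (g : F[X]) (n k b : ℕ) : Set (End F (Fin n → F) × (Fin n → F)) :=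
  {s | ∃ (φ : ((Fin b → F) × AdjoinRoot (g ^ k)) ≃ₗ[F] (Fin n → F)) (Y : End F (Fin b → F))
        (B : (Fin b → F) →ₗ[F] AdjoinRoot (g ^ k)),
        IsNilpotent (aeval Y g) ∧ φ (0, 1) = s.2 ∧
          ∀ w a, s.1 (φ (w, a)) = φ (Y w, rootMul (g ^ k) a + B w)}

theorem isNilpotent_aeval_conj {V W : Type*} [AddCommGroup V] [Module F V] [AddCommGroup W]
    [Module F W] (e : V ≃ₗ[F] W) {f : End F V} {p : F[X]} (hf : IsNilpotent (aeval f p)) :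
    IsNilpotent (aeval (e.conj f) p) :=
  isNilpotent_aeval_of_surjective e.toLinearMap (fun x => by simp [LinearEquiv.conj_apply])
    e.surjective hf

/-- The |GL_n| frames φ are acted on by the block triangular group of pairs (α, β), with α in GL_b
and β off-diagonal. The action fixes φ (0, 1) and preserves the block shape, so each pair (f, v) has
at least |GL_b| |Hom| frames. The frame together with Y and B recovers (f, v), and the factor |Hom|
cancels. -/
theorem card_blockPairs_mul_le [Finite F] {g : F[X]} (hm : g.Monic) {n k b : ℕ}
    (hn : b + k * g.natDegree = n) :
    Nat.card (blockPairs g n k b) * glCard F b ≤ glCard F n * primaryCard g b := by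
  have hp : (g ^ k).Monic := hm.pow k
  have : Module.Finite F (AdjoinRoot (g ^ k)) := hp.finite_adjoinRoot
  have hfr : finrank F ((Fin b → F) × AdjoinRoot (g ^ k)) = n := by
    rw [finrank_prod, finrank_adjoinRoot hp.ne_zero, natDegree_pow]
    simpa using hn
  have := finite_linearMap (F := F) (Fin b → F) (AdjoinRoot (g ^ k))
  have := finite_linearMap (F := F) (Fin b → F) (Fin b → F)
  have := finite_linearEquiv (F := F) (Fin b → F) (Fin b → F)
  have := finite_linearEquiv (F := F) ((Fin b → F) × AdjoinRoot (g ^ k)) (Fin n → F)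
  have key := card_mul_card_le_of_action
    (S := blockPairs g n k b) (T := End F (Fin n → F) × (Fin n → F))
    (H := ((Fin b → F) ≃ₗ[F] (Fin b → F)) × ((Fin b → F) →ₗ[F] AdjoinRoot (g ^ k)))
    (Φ := ((Fin b → F) × AdjoinRoot (g ^ k)) ≃ₗ[F] (Fin n → F))
    (D := {f : End F (Fin b → F) // IsNilpotent (aeval f g)} ×
      ((Fin b → F) →ₗ[F] AdjoinRoot (g ^ k)))
    Subtype.val Subtype.val_injective
    (fun φ x => (LinearEquiv.skewProd x.1 (LinearEquiv.refl F _) x.2).trans φ)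
    (by
      rintro φ ⟨α, β⟩ ⟨α', β'⟩ h
      have h1 : ∀ w, (α w, β w) = (α' w, β' w) := fun w => φ.injective (by
        have := LinearEquiv.congr_fun h (w, 0)
        simpa using this)
      exact Prod.ext (LinearEquiv.ext fun w => (Prod.ext_iff.1 (h1 w)).1)
        (LinearMap.ext fun w => (Prod.ext_iff.1 (h1 w)).2))
    (fun φ d => (φ.conj ((d.1.1 ∘ₗ LinearMap.fst F _ _).prod
      (rootMul (g ^ k) ∘ₗ LinearMap.snd F _ _ + d.2 ∘ₗ LinearMap.fst F _ _)), φ (0, 1)))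
    (by
      rintro ⟨⟨f, v⟩, φ, Y, B, hY, hv, hf⟩
      refine ⟨φ, ?_⟩
      rintro ⟨α, β⟩
      -- These are the blocks of f in the frame changed by (α, β): the diagonal block is conjugated
      -- and B is altered by the commutator-like terms in β.
      refine ⟨(⟨α.symm.conj Y, isNilpotent_aeval_conj _ hY⟩,
        rootMul (g ^ k) ∘ₗ β + B ∘ₗ α.toLinearMap -
          β ∘ₗ (α.symm.conj Y)), ?_⟩
      refine Prod.ext ?_ ?_
      · refine LinearMap.ext fun x => ?_
        obtain ⟨⟨w, a⟩, rfl⟩ := φ.surjective x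
        obtain ⟨⟨w', a'⟩, h⟩ := (LinearEquiv.skewProd α (LinearEquiv.refl F _) β).surjective (w, a)
        rw [← h, LinearEquiv.conj_apply_apply]
        simp only [LinearEquiv.trans_symm, LinearEquiv.trans_apply, LinearEquiv.symm_apply_apply]
        simp only [LinearEquiv.skewProd_apply]
        rw [hf]
        simp [LinearEquiv.conj_apply]
        abel_nf
      · simpa using hv)
  rw [Nat.card_prod, Nat.card_prod, card_linearEquiv hfr (by simp)] at key
  have hpos : 0 < Nat.card ((Fin b → F) →ₗ[F] AdjoinRoot (g ^ k)) := Nat.card_pos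
  refine Nat.le_of_mul_le_mul_right ?_ hpos
  rw [mul_assoc, mul_assoc]
  exact key

end Counting

/-! ### Counting primary and cyclic endomorphisms -/

section PrimaryCounting

variable {F : Type*} [Field F]

theorem finrank_ker_aeval_eq_of_injective {V W : Type*} [AddCommGroup V] [Module F V]
    [AddCommGroup W] [Module F W] {f : End F V} {f' : End F W} (φ : V →ₗ[F] W)
    (h : ∀ x, φ (f x) = f' (φ x)) (hφ : Function.Injective φ) {p : F[X]}
    (hr : LinearMap.ker (aeval f' p) ≤ LinearMap.range φ) :
    finrank F (LinearMap.ker (aeval f p)) = finrank F (LinearMap.ker (aeval f' p)) := by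
  have : (LinearMap.ker (aeval f p)).map φ = LinearMap.ker (aeval f' p) := by
    ext y
    constructor
    · rintro ⟨x, hx, rfl⟩
      rw [LinearMap.mem_ker, ← map_aeval_apply_of_semiconj φ h, LinearMap.mem_ker.1 hx, map_zero]
    · intro hy
      obtain ⟨x, rfl⟩ := hr hy
      refine ⟨x, hφ ?_, rfl⟩
      rw [map_aeval_apply_of_semiconj φ h, LinearMap.mem_ker.1 hy, map_zero]
  rw [← this]
  exact (Submodule.equivMapOfInjective φ hφ _).finrank_eq

theorem finrank_ker_aeval_conj {V W : Type*} [AddCommGroup V] [Module F V]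
    [AddCommGroup W] [Module F W] (e : V ≃ₗ[F] W) (f : End F V) (p : F[X]) :
    finrank F (LinearMap.ker (aeval (e.conj f) p)) = finrank F (LinearMap.ker (aeval f p)) :=
  (finrank_ker_aeval_eq_of_injective e.toLinearMap
    (fun x => by simp [LinearEquiv.conj_apply]) e.injective
    (fun y _ => ⟨e.symm y, by simp⟩)).symm

/-- The kernel of g on F[t]/(g^(r+1)) consists of the multiples of g^r, hence is an image of
F[t]/(g). -/
theorem finrank_ker_aeval_rootMul_le {g : F[X]} (hm : g.Monic) (r : ℕ) :
    finrank F (LinearMap.ker (aeval (rootMul (g ^ (r + 1))) g)) ≤ g.natDegree := by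
  have hp := hm.pow (r + 1)
  have : Module.Finite F (AdjoinRoot (g ^ (r + 1))) := hp.finite_adjoinRoot
  have : Module.Finite F (AdjoinRoot g) := hm.finite_adjoinRoot
  have hv : aeval (rootMul (g ^ (r + 1))) g (AdjoinRoot.mk _ (g ^ r)) = 0 := by
    rw [aeval_rootMul_apply, ← map_mul, ← pow_succ', AdjoinRoot.mk_self]
  rw [← finrank_adjoinRoot hm.ne_zero]
  refine le_trans (Submodule.finrank_mono ?_)
    (LinearMap.finrank_range_le (orbitMap hm (rootMul (g ^ (r + 1))) (AdjoinRoot.mk _ (g ^ r))))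
  intro x hx
  obtain ⟨s, rfl⟩ := AdjoinRoot.mk_surjective x
  rw [LinearMap.mem_ker, aeval_rootMul_apply, ← map_mul, AdjoinRoot.mk_eq_zero, pow_succ'] at hx
  obtain ⟨t, rfl⟩ := (mul_dvd_mul_iff_left hm.ne_zero).1 hx
  refine ⟨AdjoinRoot.mk g t, ?_⟩
  rw [orbitMap_mk hm hv, aeval_rootMul_apply, ← map_mul, mul_comm]

/-- The left side counts pairs (f, v) with f g-primary and v ≠ 0; they are sorted by the exponent k
for which v generates a copy of F[t]/(g^k). -/
theorem primaryCard_mul_le [Finite F] {g : F[X]} (hm : g.Monic) (hi : Irreducible g) (r : ℕ) :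
    primaryCard g (r * g.natDegree) * (Nat.card F ^ (r * g.natDegree) - 1) ≤
      ∑ k ∈ Finset.Icc 1 r,
        Nat.card (blockPairs g (r * g.natDegree) k ((r - k) * g.natDegree)) := by
  set n := r * g.natDegree with hn
  have := finite_linearMap (F := F) (Fin n → F) (Fin n → F)
  have h1 : ({f : End F (Fin n → F) | IsNilpotent (aeval f g)} ×ˢ {v : Fin n → F | v ≠ 0}).ncard =
      primaryCard g n * (Nat.card F ^ n - 1) := by
    rw [Set.ncard_prod]
    congr 1
    have : {v : Fin n → F | v ≠ 0} = {0}ᶜ := rfl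
    rw [this, Set.ncard_compl, Set.ncard_singleton]
    simp [Nat.card_fun]
  rw [← h1]
  refine le_trans (Set.ncard_le_ncard (t := ⋃ k ∈ Finset.Icc 1 r,
    blockPairs g n k ((r - k) * g.natDegree)) ?_ (Set.toFinite _)) ?_
  · rintro ⟨f, v⟩ ⟨hf, hv⟩
    obtain ⟨k, b, hk, hb, φ, Y, B, hY, h1, h2⟩ := exists_block_decomposition hm hi hf hv
    rw [finrank_fin_fun] at hb
    have hd := hi.natDegree_pos
    have hkr : k ≤ r := by
      refine le_of_mul_le_mul_right (a := g.natDegree) ?_ hd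
      omega
    obtain rfl : b = (r - k) * g.natDegree := by rw [Nat.sub_mul]; omega
    simp only [Set.mem_iUnion]
    exact ⟨k, Finset.mem_Icc.2 ⟨hk, hkr⟩, φ, Y, B, hY, h1, h2⟩
  · exact Finset.set_ncard_biUnion_le _ _

/-- The pairs `(f, v)` such that `f` is similar to multiplication by `t` on `F[t]/(p)` by a
similarity taking `1` to `v`. -/
def cyclicPairs (p : F[X]) (n : ℕ) : Set (End F (Fin n → F) × (Fin n → F)) :=
  {s | ∃ φ : AdjoinRoot p ≃ₗ[F] (Fin n → F), φ.conj (rootMul p) = s.1 ∧ φ 1 = s.2}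

/-- An isomorphism from F[t]/(p) is determined by the operator it transports and the image of 1. -/
theorem glCard_le_card_cyclicPairs [Finite F] {p : F[X]} (hp : p.Monic) :
    glCard F p.natDegree ≤ (cyclicPairs p p.natDegree).ncard := by
  have : Module.Finite F (AdjoinRoot p) := hp.finite_adjoinRoot
  have := finite_linearMap (F := F) (Fin p.natDegree → F) (Fin p.natDegree → F)
  rw [← card_linearEquiv (F := F) (V := AdjoinRoot p) (W := Fin p.natDegree → F)
    (finrank_adjoinRoot hp.ne_zero) (by simp)]
  refine Nat.card_le_card_of_injective (fun φ => (⟨(φ.conj (rootMul p), φ 1), φ, rfl, rfl⟩ :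
    cyclicPairs p p.natDegree)) ?_
  intro φ ψ h
  have h' := congrArg Subtype.val h
  obtain ⟨h1, h2⟩ := Prod.ext_iff.1 h'
  simp only at h1 h2
  have key : ∀ (φ : AdjoinRoot p ≃ₗ[F] (Fin p.natDegree → F)) (s : F[X]),
      φ (AdjoinRoot.mk p s) = aeval (φ.conj (rootMul p)) s (φ 1) := fun φ s => by
    have := map_aeval_apply_of_semiconj (f := rootMul p) (f' := φ.conj (rootMul p))
      φ.toLinearMap (fun x => by simp [LinearEquiv.conj_apply]) s 1
    rw [aeval_rootMul_apply, mul_one] at this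
    exact this
  ext1 x
  obtain ⟨s, rfl⟩ := AdjoinRoot.mk_surjective x
  rw [key, key, h1, h2]

/-- The endomorphisms of `F^n` similar to multiplication by `t` on `F[t]/(p)`. -/
def cyclicSet (p : F[X]) (n : ℕ) : Set (End F (Fin n → F)) :=
  {f | ∃ φ : AdjoinRoot p ≃ₗ[F] (Fin n → F), φ.conj (rootMul p) = f}

/-- A cyclic f occurs in as many cyclic pairs as it has generators. None of these lies in the range
of g(f), which has codimension at most deg g. -/
theorem glCard_le_card_cyclicSet_mul [Finite F] {g : F[X]} (hm : g.Monic) (hi : Irreducible g)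
    (r : ℕ) :
    glCard F ((r + 1) * g.natDegree) ≤
      (Nat.card F ^ ((r + 1) * g.natDegree) - Nat.card F ^ (r * g.natDegree)) *
        (cyclicSet (g ^ (r + 1)) ((r + 1) * g.natDegree)).ncard := by
  classical
  have hp := hm.pow (r + 1)
  have hdeg : (g ^ (r + 1)).natDegree = (r + 1) * g.natDegree := natDegree_pow _ _
  have h1 := glCard_le_card_cyclicPairs (F := F) hp
  rw [hdeg] at h1
  refine h1.trans ?_
  set n := (r + 1) * g.natDegree with hn
  have := finite_linearMap (F := F) (Fin n → F) (Fin n → F)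
  rw [Set.ncard_eq_toFinset_card _ (Set.toFinite _), Set.ncard_eq_toFinset_card _ (Set.toFinite _)]
  refine Finset.card_le_mul_card_image_of_maps_to (f := Prod.fst) ?_ _ ?_
  · rintro ⟨f, v⟩ h
    rw [Set.Finite.mem_toFinset] at h ⊢
    obtain ⟨φ, h, -⟩ := h
    exact ⟨φ, h⟩
  intro f hf
  rw [Set.Finite.mem_toFinset] at hf
  have hker : finrank F (LinearMap.ker (aeval f g)) ≤ g.natDegree := by
    obtain ⟨φ, rfl⟩ := hf
    rw [finrank_ker_aeval_conj]
    exact finrank_ker_aeval_rootMul_le hm r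
  have hrange : Nat.card F ^ (r * g.natDegree) ≤ (LinearMap.range (aeval f g) : Set (Fin n → F)).ncard := by
    have h2 := LinearMap.finrank_range_add_finrank_ker (aeval f g)
    rw [finrank_fin_fun] at h2
    have hn' : n = r * g.natDegree + g.natDegree := by rw [hn, Nat.add_mul, one_mul]
    have h3 : (LinearMap.range (aeval f g) : Set (Fin n → F)).ncard =
        Nat.card F ^ finrank F (LinearMap.range (aeval f g)) :=
      Module.natCard_eq_pow_finrank (K := F) (V := LinearMap.range (aeval f g))
    rw [h3]
    exact Nat.pow_le_pow_right Nat.card_pos (by omega)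
  have hcompl : (LinearMap.range (aeval f g) : Set (Fin n → F))ᶜ.ncard ≤
      Nat.card F ^ n - Nat.card F ^ (r * g.natDegree) := by
    rw [Set.ncard_compl]
    simp only [Nat.card_fun, Nat.card_fin]
    omega
  refine le_trans ?_ hcompl
  rw [Set.ncard_eq_toFinset_card _ (Set.toFinite _)]
  refine Finset.card_le_card_of_injOn Prod.snd ?_ ?_
  · rintro ⟨f', v⟩ h
    simp only [Finset.coe_filter, Set.Finite.mem_toFinset, Set.mem_ofPred_eq] at h
    obtain ⟨⟨φ, h1, h2⟩, rfl⟩ := h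
    simp only at h1 h2
    rw [Finset.mem_coe, Set.Finite.mem_toFinset]
    rintro ⟨w, hw⟩
    -- If v = g(f') w, then g^r already kills v, although v corresponds to 1, whose annihilator is
    -- (g^(r+1)).
    have h3 : aeval f' (g ^ r) v = 0 := by
      have h4 : aeval f' (g ^ (r + 1)) w = 0 := by
        obtain ⟨x, rfl⟩ := φ.surjective w
        have := map_aeval_apply_of_semiconj (f := rootMul (g ^ (r + 1))) (f' := f')
          φ.toLinearMap (fun x => by rw [← h1]; simp [LinearEquiv.conj_apply]) (g ^ (r + 1)) x
        rw [aeval_rootMul_apply, AdjoinRoot.mk_self, zero_mul, map_zero] at this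
        exact this.symm
      rw [pow_succ, map_mul, Module.End.mul_apply] at h4
      rwa [hw] at h4
    have h5 := map_aeval_apply_of_semiconj (f := rootMul (g ^ (r + 1))) (f' := f')
          φ.toLinearMap (fun x => by rw [← h1]; simp [LinearEquiv.conj_apply]) (g ^ r) 1
    rw [aeval_rootMul_apply, mul_one] at h5
    simp only [LinearEquiv.coe_coe, h2, h3] at h5
    rw [LinearEquiv.map_eq_zero_iff, AdjoinRoot.mk_eq_zero] at h5
    have h6 := natDegree_le_of_dvd h5 (hm.pow r).ne_zero
    rw [natDegree_pow, natDegree_pow, Nat.add_mul] at h6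
    have := hi.natDegree_pos
    omega
  · rintro ⟨f₁, v₁⟩ h1 ⟨f₂, v₂⟩ h2 h
    simp only [Finset.coe_filter, Set.mem_ofPred_eq] at h1 h2
    simp only at h
    rw [h1.2, h2.2, h]

/-- The number of noncyclic endomorphisms of `F^n` all of whose invariant factors are powers
of `g`. -/
noncomputable def noncyclicPrimaryCard (g : F[X]) (n : ℕ) : ℕ :=
  Nat.card {f : End F (Fin n → F) //
    IsNilpotent (aeval f g) ∧ g.natDegree < finrank F (LinearMap.ker (aeval f g))}

theorem noncyclicPrimaryCard_add_le [Finite F] {g : F[X]} (hm : g.Monic) (r n : ℕ) :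
    noncyclicPrimaryCard g n + (cyclicSet (g ^ (r + 1)) n).ncard ≤ primaryCard g n := by
  have := finite_linearMap (F := F) (Fin n → F) (Fin n → F)
  have h1 : noncyclicPrimaryCard g n = {f : End F (Fin n → F) |
    IsNilpotent (aeval f g) ∧ g.natDegree < finrank F (LinearMap.ker (aeval f g))}.ncard := rfl
  have h2 : primaryCard g n = {f : End F (Fin n → F) | IsNilpotent (aeval f g)}.ncard := rfl
  rw [h1, h2, ← Set.ncard_union_eq _ (Set.toFinite _) (Set.toFinite _)]
  · refine Set.ncard_le_ncard ?_ (Set.toFinite _)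
    rintro f (hf | ⟨φ, rfl⟩)
    · exact hf.1
    · refine isNilpotent_aeval_conj _ ⟨r + 1, LinearMap.ext fun x => ?_⟩
      rw [← map_pow, aeval_rootMul_apply, AdjoinRoot.mk_self, zero_mul]
      rfl
  · rw [Set.disjoint_left]
    rintro f ⟨-, hf⟩ ⟨φ, rfl⟩
    rw [finrank_ker_aeval_conj] at hf
    exact absurd (finrank_ker_aeval_rootMul_le hm r) (not_le.2 hf)

end PrimaryCounting

/-! ### Bounds for a single irreducible polynomial -/

section Bounds

theorem sum_range_pow_div_prod (X : ℝ) (hX : 0 < X) (hX1 : X < 1) (r : ℕ) :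
    ∑ j ∈ Finset.range (r + 1), X ^ j / ∏ i ∈ Finset.range j, (1 - X ^ (i + 1)) =
      1 / ∏ i ∈ Finset.range r, (1 - X ^ (i + 1)) := by
  have hpos : ∀ i : ℕ, (0 : ℝ) < 1 - X ^ (i + 1) := fun i =>
    sub_pos.2 (pow_lt_one₀ hX.le hX1 (by omega))
  induction r with
  | zero => simp
  | succ r ih =>
    rw [Finset.sum_range_succ, ih, Finset.prod_range_succ]
    have h1 := (Finset.prod_pos fun i (_ : i ∈ Finset.range r) => hpos i).ne'
    have h2 := (hpos r).ne'
    field_simp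
    ring

/-- The bound solves the recursion with equality, by `sum_range_pow_div_prod`. -/
theorem le_pow_div_prod_of_recursion {X : ℝ} (hX : 0 < X) (hX1 : X < 1) {e : ℕ → ℝ}
    (h0 : e 0 ≤ 1)
    (h : ∀ r, e r * (X⁻¹ ^ r - 1) ≤ ∑ j ∈ Finset.range r, e j) (r : ℕ) :
    e r ≤ X ^ r / ∏ i ∈ Finset.range r, (1 - X ^ (i + 1)) := by
  induction r using Nat.strong_induction_on with
  | _ r ih =>
    rcases r with _ | r
    · simpa using h0
    have hpos : ∀ i : ℕ, (0 : ℝ) < 1 - X ^ (i + 1) := fun i =>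
      sub_pos.2 (pow_lt_one₀ hX.le hX1 (by omega))
    have h1 := (h (r + 1)).trans (Finset.sum_le_sum fun j hj => ih j (Finset.mem_range.1 hj))
    rw [sum_range_pow_div_prod X hX hX1] at h1
    have hXr : (0 : ℝ) < X ^ (r + 1) := by positivity
    have h2 := Finset.prod_pos fun i (_ : i ∈ Finset.range r) => hpos i
    have h3 : X⁻¹ ^ (r + 1) - 1 = (1 - X ^ (r + 1)) / X ^ (r + 1) := by
      rw [inv_pow]; field_simp
    rw [h3] at h1
    have h4 : 0 < (1 - X ^ (r + 1)) / X ^ (r + 1) := div_pos (hpos r) hXr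
    rw [← le_div_iff₀ h4] at h1
    refine h1.trans (le_of_eq ?_)
    rw [Finset.prod_range_succ]
    have h5 := (hpos r).ne'
    field_simp

/-- This is ∏ (1 - a_i) ≥ 1 - ∑ a_i with the geometric sum evaluated. -/
theorem one_sub_le_prod {X : ℝ} (hX : 0 < X) (hX1 : X < 1) (r : ℕ) :
    1 - (X ^ 2 - X ^ (r + 2)) / (1 - X) ≤ ∏ i ∈ Finset.range r, (1 - X ^ (i + 2)) := by
  have h1 : (0 : ℝ) < 1 - X := sub_pos.2 hX1
  induction r with
  | zero => simp
  | succ r ih =>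
    rw [Finset.prod_range_succ]
    have h2 : ∏ i ∈ Finset.range r, (1 - X ^ (i + 2)) ≤ 1 :=
      Finset.prod_le_one
        (fun i _ => sub_nonneg.2 (pow_le_one₀ hX.le hX1.le)) (fun i _ => sub_le_self _ (by positivity))
    have h3 : (X ^ 2 - X ^ (r + 1 + 2)) / (1 - X) = (X ^ 2 - X ^ (r + 2)) / (1 - X) + X ^ (r + 2) := by
      field_simp; ring
    have h4 : (0 : ℝ) < X ^ (r + 2) := by positivity
    rw [h3]
    nlinarith

/-- The coefficient `(X^r / ∏_{i ≤ r} (1 - X^i)) - X^r / (1 - X)`, for `r ≥ 1`, is at most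
`X^(r + 2) / ((1 - X) (1 - X - X²))`. -/
theorem pow_div_prod_sub_le {X : ℝ} (hX : 0 < X) (hX1 : X ≤ 1 / 2) (r : ℕ) :
    X ^ (r + 1) / ∏ i ∈ Finset.range (r + 1), (1 - X ^ (i + 1)) - X ^ (r + 1) / (1 - X) ≤
      X ^ (r + 3) / ((1 - X) * (1 - X - X ^ 2)) := by
  have h1 : (0 : ℝ) < 1 - X := by linarith
  have hc : (0 : ℝ) < 1 - X - X ^ 2 := by nlinarith
  rw [Finset.prod_range_succ']
  have h2 := one_sub_le_prod hX (by linarith) r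
  have h3 : (1 - X - X ^ 2) / (1 - X) ≤ ∏ i ∈ Finset.range r, (1 - X ^ (i + 2)) := by
    refine le_trans ?_ h2
    have h4 : (0 : ℝ) < X ^ (r + 2) := by positivity
    rw [div_le_iff₀ h1, sub_mul, div_mul_cancel₀ _ h1.ne']
    linarith
  have h5 : 0 < (1 - X - X ^ 2) / (1 - X) := by positivity
  have h6 : X ^ (r + 1) / ((∏ i ∈ Finset.range r, (1 - X ^ (i + 1 + 1))) * (1 - X ^ (0 + 1))) ≤
      X ^ (r + 1) / (((1 - X - X ^ 2) / (1 - X)) * (1 - X ^ (0 + 1))) := by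
    simp only [zero_add, pow_one]
    gcongr
  refine (sub_le_sub_right h6 _).trans (le_of_eq ?_)
  have h1' := h1.ne'
  have hc' := hc.ne'
  rw [zero_add, pow_one]
  field_simp
  ring

variable {F : Type*} [Field F]

theorem natDegree_dvd_of_isNilpotent_aeval {g : F[X]} (hm : g.Monic) (hi : Irreducible g) (n : ℕ)
    (f : End F (Fin n → F)) (hf : IsNilpotent (aeval f g)) : g.natDegree ∣ n := by
  induction n using Nat.strong_induction_on with
  | _ n ih =>
    rcases n.eq_zero_or_pos with rfl | hn
    · exact dvd_zero _
    have : Nonempty (Fin n) := ⟨⟨0, hn⟩⟩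
    obtain ⟨v, hv⟩ := exists_ne (0 : Fin n → F)
    obtain ⟨k, b, hk, hb, φ, Y, B, hY, -, -⟩ := exists_block_decomposition hm hi hf hv
    rw [finrank_fin_fun] at hb
    have h1 : 1 * 1 ≤ k * g.natDegree := Nat.mul_le_mul hk hi.natDegree_pos
    rw [← hb]
    exact dvd_add (ih b (by omega) Y hY) (dvd_mul_left _ _)

variable [Finite F]

theorem primaryCard_div_glCard_le {g : F[X]} (hm : g.Monic) (hi : Irreducible g) {X : ℝ}
    (hX : X = ((Nat.card F : ℝ) ^ g.natDegree)⁻¹) (r : ℕ) :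
    (primaryCard g (r * g.natDegree) : ℝ) / glCard F (r * g.natDegree) ≤
      X ^ r / ∏ i ∈ Finset.range r, (1 - X ^ (i + 1)) := by
  have hq : (1 : ℝ) < Nat.card F := by exact_mod_cast Finite.one_lt_card
  have hQ : (1 : ℝ) < (Nat.card F : ℝ) ^ g.natDegree := one_lt_pow₀ hq hi.natDegree_pos.ne'
  have hgl : ∀ n, (0 : ℝ) < glCard F n := fun n => by exact_mod_cast glCard_pos n
  refine le_pow_div_prod_of_recursion
    (e := fun r => (primaryCard g (r * g.natDegree) : ℝ) / glCard F (r * g.natDegree))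
    (by rw [hX]; positivity) (by rw [hX]; exact inv_lt_one_of_one_lt₀ hQ) ?_ (fun r => ?_) r
  · have : primaryCard g 0 ≤ 1 := by
      refine Finite.card_le_one_iff_subsingleton.2 ⟨fun a b => ?_⟩
      ext x i
      exact i.elim0
    simp only [zero_mul, glCard_zero]
    simpa using this
  · have h1 := primaryCard_mul_le hm hi r
    have h2 : ((primaryCard g (r * g.natDegree) * (Nat.card F ^ (r * g.natDegree) - 1) : ℕ) : ℝ) =
        primaryCard g (r * g.natDegree) * (X⁻¹ ^ r - 1) := by
      rw [Nat.cast_mul, Nat.cast_sub (Nat.one_le_pow _ _ Nat.card_pos), hX, inv_inv, ← pow_mul,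
        mul_comm g.natDegree]
      simp
    rw [div_mul_eq_mul_div, div_le_iff₀ (hgl _), ← h2]
    refine (Nat.cast_le.2 h1).trans ?_
    rw [Nat.cast_sum, Finset.sum_mul, Finset.sum_bij' (i := fun k _ => r - k)
      (j := fun k _ => r - k) (t := Finset.range r)
      (g := fun j => (Nat.card (blockPairs g (r * g.natDegree) (r - j) (j * g.natDegree)) : ℝ))]
    · refine Finset.sum_le_sum fun j hj => ?_
      have hj' := Finset.mem_range.1 hj
      have h3 := card_blockPairs_mul_le hm (n := r * g.natDegree) (k := r - j)
        (b := j * g.natDegree) (by rw [← Nat.add_mul]; congr 1; omega)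
      rw [div_mul_eq_mul_div, le_div_iff₀ (hgl _), mul_comm (primaryCard g _ : ℝ)]
      exact_mod_cast h3
    · intro k hk; simp at hk ⊢; omega
    · intro k hk; simp at hk ⊢; omega
    · intro k hk; simp at hk ⊢; omega
    · intro k hk; simp at hk ⊢; omega
    · intro k hk
      have := Finset.mem_Icc.1 hk
      rw [Nat.sub_sub_self this.2]

theorem noncyclicPrimaryCard_div_glCard_le {g : F[X]} (hm : g.Monic) (hi : Irreducible g) {X : ℝ}
    (hX : X = ((Nat.card F : ℝ) ^ g.natDegree)⁻¹) (r : ℕ) :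
    (noncyclicPrimaryCard g ((r + 1) * g.natDegree) : ℝ) / glCard F ((r + 1) * g.natDegree) ≤
      X ^ (r + 1) / ∏ i ∈ Finset.range (r + 1), (1 - X ^ (i + 1)) - X ^ (r + 1) / (1 - X) := by
  have hq : (1 : ℝ) < Nat.card F := by exact_mod_cast Finite.one_lt_card
  have hQ : (1 : ℝ) < (Nat.card F : ℝ) ^ g.natDegree := one_lt_pow₀ hq hi.natDegree_pos.ne'
  have hgl : ∀ n, (0 : ℝ) < glCard F n := fun n => by exact_mod_cast glCard_pos n
  refine le_trans ?_ (sub_le_sub_right (primaryCard_div_glCard_le hm hi hX (r + 1)) _)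
  have h1 : (noncyclicPrimaryCard g ((r + 1) * g.natDegree) : ℝ) +
      (cyclicSet (g ^ (r + 1)) ((r + 1) * g.natDegree)).ncard ≤
      primaryCard g ((r + 1) * g.natDegree) := by
    exact_mod_cast noncyclicPrimaryCard_add_le hm r _
  have h2 : (glCard F ((r + 1) * g.natDegree) : ℝ) ≤
      ((Nat.card F : ℝ) ^ ((r + 1) * g.natDegree) - (Nat.card F : ℝ) ^ (r * g.natDegree)) *
        (cyclicSet (g ^ (r + 1)) ((r + 1) * g.natDegree)).ncard := by
    have h3 := glCard_le_card_cyclicSet_mul hm hi r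
    have h4 : Nat.card F ^ (r * g.natDegree) ≤ Nat.card F ^ ((r + 1) * g.natDegree) :=
      Nat.pow_le_pow_right Nat.card_pos (Nat.mul_le_mul_right _ (by omega))
    have h5 : (glCard F ((r + 1) * g.natDegree) : ℝ) ≤ _ := Nat.cast_le.2 h3
    rw [Nat.cast_mul, Nat.cast_sub h4] at h5
    simpa using h5
  -- The subtracted term is the reciprocal of the bound on the number of generators of a cyclic
  -- endomorphism.
  have h6 : X ^ (r + 1) / (1 - X) =
      ((Nat.card F : ℝ) ^ ((r + 1) * g.natDegree) - (Nat.card F : ℝ) ^ (r * g.natDegree))⁻¹ := by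
    rw [mul_comm, pow_mul, mul_comm r, pow_mul]
    set Q := (Nat.card F : ℝ) ^ g.natDegree with hQdef
    have h7 : Q - 1 ≠ 0 := by linarith
    have h8 : Q ≠ 0 := by linarith
    have h9 : Q ^ (r + 1) - Q ^ r = Q ^ r * (Q - 1) := by ring
    rw [hX, h9, inv_pow]
    field_simp
    ring
  have h10 : (0 : ℝ) < (Nat.card F : ℝ) ^ ((r + 1) * g.natDegree) -
      (Nat.card F : ℝ) ^ (r * g.natDegree) := by
    refine sub_pos.2 (pow_lt_pow_right₀ hq ?_)
    have := hi.natDegree_pos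
    rw [Nat.add_mul]
    omega
  rw [h6, div_le_iff₀ (hgl _), sub_mul, div_mul_cancel₀ _ (hgl _).ne']
  have h11 := (inv_mul_le_iff₀ h10).2 h2
  linarith

end Bounds

/-! ### Splitting off a primary component: the renewal inequality -/

section Splitting

variable {F : Type*} [Field F]

/-- No nonzero primary component of `f` is cyclic: if `g(f)` has a nontrivial kernel, then this
kernel has dimension more than one over the field `F[t]/(g)`. -/
def IsUncyclic {V : Type*} [AddCommGroup V] [Module F V] (f : End F V) : Prop :=
  ∀ g : F[X], g.Monic → Irreducible g → LinearMap.ker (aeval f g) ≠ ⊥ →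
    g.natDegree < finrank F (LinearMap.ker (aeval f g))

/-- `f` has a single primary component, which is not cyclic. -/
def IsNoncyclicPrimary {V : Type*} [AddCommGroup V] [Module F V] (f : End F V) : Prop :=
  ∃ g : F[X], g.Monic ∧ Irreducible g ∧ IsNilpotent (aeval f g) ∧
    g.natDegree < finrank F (LinearMap.ker (aeval f g))

theorem exists_monic_irreducible_ker_aeval_ne_bot {V : Type*} [AddCommGroup V] [Module F V]
    [FiniteDimensional F V] [Nontrivial V] (f : End F V) :
    ∃ g h : F[X], ∃ k, g.Monic ∧ Irreducible g ∧ LinearMap.ker (aeval f g) ≠ ⊥ ∧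
      IsCoprime (g ^ (k + 1)) h ∧ aeval f (g ^ (k + 1) * h) = 0 := by
  have hint : IsIntegral F f := Algebra.IsIntegral.isIntegral f
  have h0 := minpoly.ne_zero hint
  have hnu : ¬ IsUnit (minpoly F f) := minpoly.not_isUnit F f
  obtain ⟨g, hm, hi, hg⟩ := exists_monic_irreducible_factor _ hnu
  have hfin : FiniteMultiplicity g (minpoly F f) :=
    finiteMultiplicity_of_degree_pos_of_monic (natDegree_pos_iff_degree_pos.1 hi.natDegree_pos) hm h0
  obtain ⟨h, hn, hh⟩ := hfin.exists_eq_pow_mul_and_not_dvd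
  obtain ⟨k, hk⟩ : ∃ k, multiplicity g (minpoly F f) = k + 1 := by
    refine Nat.exists_eq_succ_of_ne_zero fun h1 => hh ?_
    rw [h1, pow_zero, one_mul] at hn
    exact hn ▸ hg
  rw [hk] at hn
  refine ⟨g, h, k, hm, hi, fun hbot => ?_, (hi.coprime_iff_not_dvd.2 hh).pow_left, ?_⟩
  -- Were g(f) injective, the cofactor of g in the minimal polynomial would already annihilate f.
  · obtain ⟨c, hc⟩ := hg
    have h1 : aeval f c = 0 := by
      refine LinearMap.ext fun x => ?_
      have h2 : aeval f c x ∈ LinearMap.ker (aeval f g) := by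
        rw [LinearMap.mem_ker, ← Module.End.mul_apply, ← map_mul, ← hc, minpoly.aeval]
        rfl
      rw [hbot, Submodule.mem_bot] at h2
      exact h2
    have hc0 : c ≠ 0 := by
      rintro rfl
      rw [mul_zero] at hc
      exact h0 hc
    have h3 := natDegree_le_of_dvd (minpoly.dvd F f h1) hc0
    rw [hc, natDegree_mul hm.ne_zero hc0] at h3
    have := hi.natDegree_pos
    omega
  · rw [← hn, minpoly.aeval]

/-- Used to restrict f' to the complementary summand ker h(f'). Only factors of h can have a kernel
there, and for those the kernel is the same as on the whole space. -/
theorem isUncyclic_of_semiconj {V W : Type*} [AddCommGroup V] [Module F V]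
    [AddCommGroup W] [Module F W] {f : End F V} {f' : End F W} {h : F[X]} (φ : V →ₗ[F] W)
    (hφ : ∀ x, φ (f x) = f' (φ x)) (hinj : Function.Injective φ)
    (hr : LinearMap.ker (aeval f' h) ≤ LinearMap.range φ) (hf : aeval f h = 0)
    (hf' : IsUncyclic f') : IsUncyclic f := by
  intro g hm hi hker
  have hgh : g ∣ h := by
    by_contra hgh
    apply hker
    obtain ⟨a, b, hab⟩ := (hi.coprime_iff_not_dvd.2 hgh)
    rw [eq_bot_iff]
    intro x hx
    have : aeval f (a * g + b * h) x = 0 := by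
      simp [hf, LinearMap.mem_ker.1 hx]
    simpa [hab] using this
  have hle : LinearMap.ker (aeval f' g) ≤ LinearMap.range φ := by
    refine le_trans (fun x hx => ?_) hr
    obtain ⟨c, rfl⟩ := hgh
    rw [LinearMap.mem_ker, mul_comm, map_mul, Module.End.mul_apply, LinearMap.mem_ker.1 hx, map_zero]
  rw [finrank_ker_aeval_eq_of_injective φ hφ hinj hle]
  refine hf' g hm hi fun hbot => hker ?_
  rw [eq_bot_iff]
  intro x hx
  have : φ x ∈ LinearMap.ker (aeval f' g) := by
    rw [LinearMap.mem_ker, ← map_aeval_apply_of_semiconj φ hφ, LinearMap.mem_ker.1 hx, map_zero]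
  rw [hbot, Submodule.mem_bot] at this
  exact hinj (by rw [this, map_zero])

/-- An uncyclic endomorphism splits off a noncyclic primary block. -/
theorem IsUncyclic.exists_split {n : ℕ} (hn : 1 ≤ n) {f : End F (Fin n → F)}
    (hf : IsUncyclic f) : ∃ m ∈ Finset.Icc 1 n,
      ∃ (φ : ((Fin m → F) × (Fin (n - m) → F)) ≃ₗ[F] (Fin n → F)) (Y : End F (Fin m → F))
        (Z : End F (Fin (n - m) → F)), IsNoncyclicPrimary Y ∧ IsUncyclic Z ∧
          φ.conj (Y.prodMap Z) = f := by
  have : Nonempty (Fin n) := ⟨⟨0, hn⟩⟩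
  obtain ⟨g, h, k, hm, hi, hker, hco, hz⟩ := exists_monic_irreducible_ker_aeval_ne_bot f
  set P := LinearMap.ker (aeval f (g ^ (k + 1))) with hP
  set R := LinearMap.ker (aeval f h) with hR
  have hc : IsCompl P R := by
    refine ⟨disjoint_ker_aeval_of_isCoprime f hco, ?_⟩
    rw [codisjoint_iff, hP, hR, sup_ker_aeval_eq_ker_aeval_mul_of_coprime f hco, hz,
      LinearMap.ker_zero]
  have hinv : ∀ p : F[X], ∀ x ∈ LinearMap.ker (aeval f p), f x ∈ LinearMap.ker (aeval f p) := by
    intro p x hx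
    rw [LinearMap.mem_ker] at hx ⊢
    rw [← map_aeval_apply_of_semiconj f (fun _ => rfl), hx, map_zero]
  have hsum := Submodule.finrank_add_eq_of_isCompl hc
  rw [finrank_fin_fun] at hsum
  let eP : (Fin (finrank F P) → F) ≃ₗ[F] P := (finBasis F P).equivFun.symm
  let eR : (Fin (n - finrank F P) → F) ≃ₗ[F] R :=
    LinearEquiv.ofFinrankEq _ _ (by rw [finrank_fin_fun]; omega)
  let fP : End F P := f.restrict (hinv _)
  let fR : End F R := f.restrict (hinv _)
  have hsubP : ∀ x, P.subtype (fP x) = f (P.subtype x) := fun x => rfl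
  have hsubR : ∀ x, R.subtype (fR x) = f (R.subtype x) := fun x => rfl
  have hgP : LinearMap.ker (aeval f g) ≤ P := by
    intro x hx
    rw [hP, LinearMap.mem_ker, pow_succ, map_mul, Module.End.mul_apply, LinearMap.mem_ker.1 hx,
      map_zero]
  have hkerP : finrank F (LinearMap.ker (aeval fP g)) = finrank F (LinearMap.ker (aeval f g)) :=
    finrank_ker_aeval_eq_of_injective P.subtype hsubP P.subtype_injective (by simpa using hgP)
  have hgt := hf g hm hi hker
  refine ⟨finrank F P, Finset.mem_Icc.2 ⟨?_, by omega⟩,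
    (eP.prodCongr eR).trans (Submodule.prodEquivOfIsCompl _ _ hc), eP.symm.conj fP,
    eR.symm.conj fR, ⟨g, hm, hi, ?_, ?_⟩, ?_, ?_⟩
  · exact (Nat.zero_lt_of_lt hgt).trans_le (Submodule.finrank_mono hgP)
  · refine isNilpotent_aeval_conj _ ⟨k + 1, LinearMap.ext fun x => P.subtype_injective ?_⟩
    rw [← map_pow, map_aeval_apply_of_semiconj P.subtype hsubP]
    rw [LinearMap.zero_apply, map_zero]
    exact LinearMap.mem_ker.1 x.2
  · rw [finrank_ker_aeval_conj, hkerP]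
    exact hgt
  · refine isUncyclic_of_semiconj (h := h) (R.subtype ∘ₗ eR.toLinearMap) (f' := f) ?_
      (R.subtype_injective.comp eR.injective) ?_ ?_ hf
    · intro x
      simp [LinearEquiv.conj_apply, fR]
    · rw [LinearMap.range_comp, LinearEquiv.range, Submodule.map_top, Submodule.range_subtype]
    · refine LinearMap.ext fun x => (R.subtype_injective.comp eR.injective) ?_
      have := map_aeval_apply_of_semiconj (f := eR.symm.conj fR) (f' := f)
        (R.subtype ∘ₗ eR.toLinearMap) (fun x => by simp [LinearEquiv.conj_apply, fR]) h x
      simp only [LinearMap.comp_apply, LinearEquiv.coe_coe] at this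
      simp only [Function.comp_apply, this, LinearMap.zero_apply, map_zero]
      exact LinearMap.mem_ker.1 (eR x).2
  · refine LinearMap.ext fun x => ?_
    obtain ⟨⟨w, z⟩, rfl⟩ :=
      ((eP.prodCongr eR).trans (Submodule.prodEquivOfIsCompl _ _ hc)).surjective x
    rw [LinearEquiv.conj_apply_apply, LinearEquiv.symm_apply_apply]
    simp [LinearEquiv.conj_apply, fP, fR, Submodule.coe_prodEquivOfIsCompl']

variable (F) in
/-- The number of uncyclic endomorphisms of `F^n`. -/
noncomputable def uncyclicCard (n : ℕ) : ℕ := Nat.card {f : End F (Fin n → F) // IsUncyclic f}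

variable (F) in
/-- The number of noncyclic endomorphisms of `F^n` with a single primary component. -/
noncomputable def noncyclicPrimaryTotal (n : ℕ) : ℕ :=
  Nat.card {f : End F (Fin n → F) // IsNoncyclicPrimary f}

theorem card_split_mul_le [Finite F] {n m : ℕ} (hmn : m ≤ n) :
    {f : End F (Fin n → F) |
      ∃ (φ : ((Fin m → F) × (Fin (n - m) → F)) ≃ₗ[F] (Fin n → F)) (Y : End F (Fin m → F))
        (Z : End F (Fin (n - m) → F)), IsNoncyclicPrimary Y ∧ IsUncyclic Z ∧
          φ.conj (Y.prodMap Z) = f}.ncard * (glCard F m * glCard F (n - m)) ≤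
      glCard F n * (noncyclicPrimaryTotal F m * uncyclicCard F (n - m)) := by
  have hfr : finrank F ((Fin m → F) × (Fin (n - m) → F)) = n := by simp; omega
  have := finite_linearMap (F := F) (Fin m → F) (Fin m → F)
  have := finite_linearMap (F := F) (Fin (n - m) → F) (Fin (n - m) → F)
  have := finite_linearEquiv (F := F) ((Fin m → F) × (Fin (n - m) → F)) (Fin n → F)
  have hprim : ∀ (α : (Fin m → F) ≃ₗ[F] (Fin m → F)) {Y : End F (Fin m → F)},
      IsNoncyclicPrimary Y → IsNoncyclicPrimary (α.conj Y) := by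
    rintro α Y ⟨g, hm, hi, h1, h2⟩
    exact ⟨g, hm, hi, isNilpotent_aeval_conj _ h1, by rwa [finrank_ker_aeval_conj]⟩
  have hunc : ∀ (β : (Fin (n - m) → F) ≃ₗ[F] (Fin (n - m) → F)) {Z : End F (Fin (n - m) → F)},
      IsUncyclic Z → IsUncyclic (β.conj Z) := by
    intro β Z hZ g hm hi hk
    rw [finrank_ker_aeval_conj]
    refine hZ g hm hi fun h => hk ?_
    have h3 := finrank_ker_aeval_conj β Z g
    rw [h, finrank_bot] at h3
    exact Submodule.finrank_eq_zero.1 h3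
  have key := card_mul_card_le_of_action
    (S := {f : End F (Fin n → F) |
      ∃ (φ : ((Fin m → F) × (Fin (n - m) → F)) ≃ₗ[F] (Fin n → F)) (Y : End F (Fin m → F))
        (Z : End F (Fin (n - m) → F)), IsNoncyclicPrimary Y ∧ IsUncyclic Z ∧
          φ.conj (Y.prodMap Z) = f})
    (H := ((Fin m → F) ≃ₗ[F] (Fin m → F)) × ((Fin (n - m) → F) ≃ₗ[F] (Fin (n - m) → F)))
    (Φ := ((Fin m → F) × (Fin (n - m) → F)) ≃ₗ[F] (Fin n → F))
    (D := {f : End F (Fin m → F) // IsNoncyclicPrimary f} ×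
      {f : End F (Fin (n - m) → F) // IsUncyclic f})
    Subtype.val Subtype.val_injective
    (fun φ x => (x.1.prodCongr x.2).trans φ)
    (by
      rintro φ ⟨α, β⟩ ⟨α', β'⟩ h
      have h1 : ∀ w z, (α w, β z) = (α' w, β' z) := fun w z => φ.injective
        (LinearEquiv.congr_fun h (w, z))
      exact Prod.ext (LinearEquiv.ext fun w => (Prod.ext_iff.1 (h1 w 0)).1)
        (LinearEquiv.ext fun z => (Prod.ext_iff.1 (h1 0 z)).2))
    (fun φ d => φ.conj (d.1.1.prodMap d.2.1))
    (by
      rintro ⟨_, φ, Y, Z, hY, hZ, rfl⟩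
      refine ⟨φ, ?_⟩
      rintro ⟨α, β⟩
      refine ⟨(⟨α.symm.conj Y, hprim _ hY⟩, ⟨β.symm.conj Z, hunc _ hZ⟩), ?_⟩
      refine LinearMap.ext fun x => ?_
      obtain ⟨⟨w, z⟩, rfl⟩ := ((α.prodCongr β).trans φ).surjective x
      rw [LinearEquiv.conj_apply_apply, LinearEquiv.symm_apply_apply]
      simp [LinearEquiv.conj_apply])
  rw [Nat.card_prod, Nat.card_prod, card_linearEquiv hfr (by simp)] at key
  exact key

/-- Union bound over the dimension m of the component split off. The component is not canonical, so
an endomorphism may be counted several times; only an inequality results. -/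
theorem uncyclicCard_div_le [Finite F] {n : ℕ} (hn : 1 ≤ n) :
    (uncyclicCard F n : ℝ) / glCard F n ≤ ∑ m ∈ Finset.Icc 1 n,
      (noncyclicPrimaryTotal F m : ℝ) / glCard F m *
        ((uncyclicCard F (n - m) : ℝ) / glCard F (n - m)) := by
  have := finite_linearMap (F := F) (Fin n → F) (Fin n → F)
  have hgl : ∀ n, (0 : ℝ) < glCard F n := fun n => by exact_mod_cast glCard_pos n
  have h1 : uncyclicCard F n ≤ ∑ m ∈ Finset.Icc 1 n, {f : End F (Fin n → F) |
      ∃ (φ : ((Fin m → F) × (Fin (n - m) → F)) ≃ₗ[F] (Fin n → F)) (Y : End F (Fin m → F))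
        (Z : End F (Fin (n - m) → F)), IsNoncyclicPrimary Y ∧ IsUncyclic Z ∧
          φ.conj (Y.prodMap Z) = f}.ncard := by
    refine le_trans ?_ (Finset.set_ncard_biUnion_le _ _)
    refine Set.ncard_le_ncard (s := {f : End F (Fin n → F) | IsUncyclic f}) ?_ (Set.toFinite _)
    intro f hf
    obtain ⟨m, hm, h⟩ := IsUncyclic.exists_split hn hf
    simp only [Set.mem_iUnion]
    exact ⟨m, hm, h⟩
  rw [div_le_iff₀ (hgl n), Finset.sum_mul]
  refine (Nat.cast_le.2 h1).trans ?_
  rw [Nat.cast_sum]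
  refine Finset.sum_le_sum fun m hm => ?_
  have h2 := card_split_mul_le (F := F) (Finset.mem_Icc.1 hm).2
  rw [div_mul_div_comm, div_mul_eq_mul_div, le_div_iff₀ (mul_pos (hgl _) (hgl _)),
    mul_comm _ (glCard F n : ℝ)]
  exact_mod_cast h2

end Splitting

/-! ### Summing over irreducible polynomials -/

section Density

theorem sum_Icc_two_pow_le {x : ℝ} (hx : 0 ≤ x) (hx1 : x < 1) (m : ℕ) :
    ∑ d ∈ Finset.Icc 2 m, x ^ d ≤ x ^ 2 / (1 - x) := by
  have h1 : (0 : ℝ) < 1 - x := sub_pos.2 hx1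
  rcases Nat.lt_or_ge m 1 with h | h
  · obtain rfl : m = 0 := by omega
    simp
    positivity
  have : Finset.Icc 2 m = Finset.Ico 2 (m + 1) := by ext; simp
  rw [this, geom_sum_Ico' hx1.ne (by omega)]
  gcongr
  exact sub_le_self _ (by positivity)

variable (F : Type*) [Field F] [Finite F]

theorem ncard_monic_irreducible_le (d : ℕ) :
    {g : F[X] | g.Monic ∧ Irreducible g ∧ g.natDegree = d}.Finite ∧
      {g : F[X] | g.Monic ∧ Irreducible g ∧ g.natDegree = d}.ncard ≤ Nat.card F ^ d := by
  let e : {p : F[X] // p.Monic ∧ p.natDegree = d} ≃ (Fin d → F) :=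
    (monicEquivDegreeLT d).trans (degreeLTEquiv F d).toEquiv
  have hsub : {g : F[X] | g.Monic ∧ Irreducible g ∧ g.natDegree = d} ⊆
      {g : F[X] | g.Monic ∧ g.natDegree = d} := fun g hg => ⟨hg.1, hg.2.2⟩
  have hfin : {g : F[X] | g.Monic ∧ g.natDegree = d}.Finite := Finite.of_equiv _ e.symm
  refine ⟨hfin.subset hsub, (Set.ncard_le_ncard hsub hfin).trans (le_of_eq ?_)⟩
  have := Nat.card_congr e
  rw [Nat.card_fun, Nat.card_fin] at this
  exact this

/-- Summing over the monic irreducible polynomials: if the proportion of noncyclic `g`-primary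
endomorphisms of `F^m` is at most `B (deg g)`, the total is bounded accordingly. -/
theorem noncyclicPrimaryTotal_div_le (m : ℕ) (B : ℕ → ℝ)
    (hB : ∀ g : F[X], g.Monic → Irreducible g → g.natDegree ∣ m →
      (noncyclicPrimaryCard g m : ℝ) / glCard F m ≤ B g.natDegree)
    (hB0 : ∀ d, 0 ≤ B d) (hm : m ≠ 0) :
    (noncyclicPrimaryTotal F m : ℝ) / glCard F m ≤
      ∑ d ∈ m.divisors, (Nat.card F : ℝ) ^ d * B d := by
  classical
  have := finite_linearMap (F := F) (Fin m → F) (Fin m → F)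
  have hgl : (0 : ℝ) < glCard F m := by exact_mod_cast glCard_pos m
  let I : ℕ → Finset F[X] := fun d => (ncard_monic_irreducible_le F d).1.toFinset
  have hI : ∀ d g, g ∈ I d ↔ g.Monic ∧ Irreducible g ∧ g.natDegree = d := fun d g => by simp [I]
  have h1 : noncyclicPrimaryTotal F m ≤
      ∑ d ∈ m.divisors, ∑ g ∈ I d, noncyclicPrimaryCard g m := by
    have hle : {f : End F (Fin m → F) | IsNoncyclicPrimary f}.ncard ≤
        (⋃ p ∈ m.divisors.sigma I, {f : End F (Fin m → F) | IsNilpotent (aeval f p.2) ∧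
          p.2.natDegree < finrank F (LinearMap.ker (aeval f p.2))}).ncard := by
      refine Set.ncard_le_ncard ?_ (Set.toFinite _)
      rintro f ⟨g, hmo, hi, h2, h3⟩
      simp only [Set.mem_iUnion]
      refine ⟨⟨g.natDegree, g⟩, Finset.mem_sigma.2 ⟨Nat.mem_divisors.2
        ⟨natDegree_dvd_of_isNilpotent_aeval hmo hi m f h2, hm⟩, (hI _ _).2 ⟨hmo, hi, rfl⟩⟩, h2, h3⟩
    refine (hle.trans (Finset.set_ncard_biUnion_le _ _)).trans (le_of_eq ?_)
    rw [Finset.sum_sigma]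
    rfl
  rw [div_le_iff₀ hgl, Finset.sum_mul]
  refine (Nat.cast_le.2 h1).trans ?_
  rw [Nat.cast_sum]
  refine Finset.sum_le_sum fun d hd => ?_
  rw [Nat.cast_sum]
  have h2 : ∀ g ∈ I d, (noncyclicPrimaryCard g m : ℝ) ≤ B d * glCard F m := by
    intro g hg
    obtain ⟨hmo, hi, rfl⟩ := (hI d g).1 hg
    rw [← div_le_iff₀ hgl]
    exact hB g hmo hi (Nat.dvd_of_mem_divisors hd)
  refine (Finset.sum_le_sum h2).trans ?_
  rw [Finset.sum_const, nsmul_eq_mul, mul_assoc]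
  refine mul_le_mul_of_nonneg_right ?_ (mul_nonneg (hB0 d) hgl.le)
  have h3 := (ncard_monic_irreducible_le F d).2
  rw [Set.ncard_eq_toFinset_card _ (ncard_monic_irreducible_le F d).1] at h3
  exact_mod_cast h3

variable {F}

/-- In dimension deg g, the bounds for all and for cyclic g-primary endomorphisms coincide. -/
theorem noncyclicPrimaryCard_self_nonpos {g : F[X]} (hm : g.Monic) (hi : Irreducible g) :
    (noncyclicPrimaryCard g g.natDegree : ℝ) / glCard F g.natDegree ≤ 0 := by
  have := noncyclicPrimaryCard_div_glCard_le hm hi rfl 0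
  simpa using this

theorem noncyclicPrimaryCard_two_le {g : F[X]} (hm : g.Monic) (hi : Irreducible g) {x : ℝ}
    (hx : x = (Nat.card F : ℝ)⁻¹) (hd : g.natDegree = 1) :
    (noncyclicPrimaryCard g 2 : ℝ) / glCard F 2 ≤ x ^ 4 / ((1 - x) * (1 - x ^ 2)) := by
  have hq : (1 : ℝ) < Nat.card F := by exact_mod_cast Finite.one_lt_card
  have hx0 : 0 < x := by rw [hx]; positivity
  have hx1 : x < 1 := by rw [hx]; exact inv_lt_one_of_one_lt₀ hq
  have h := noncyclicPrimaryCard_div_glCard_le hm hi (X := x) (by rw [hd, pow_one, hx]) 1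
  rw [hd] at h
  refine h.trans (le_of_eq ?_)
  have h1 : 1 - x ≠ 0 := by linarith
  have h2 : 1 - x ^ 2 ≠ 0 := by nlinarith
  simp only [Finset.prod_range_succ, Finset.prod_range_zero]
  norm_num
  field_simp
  ring

theorem noncyclicPrimaryCard_le {g : F[X]} (hm : g.Monic) (hi : Irreducible g) {x : ℝ}
    (hx : x = (Nat.card F : ℝ)⁻¹) {m : ℕ} (hm0 : m ≠ 0) (hd : g.natDegree ∣ m) :
    (noncyclicPrimaryCard g m : ℝ) / glCard F m ≤
      x ^ (m + 2 * g.natDegree) /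
        ((1 - x ^ g.natDegree) * (1 - x ^ g.natDegree - (x ^ g.natDegree) ^ 2)) := by
  have hq : (2 : ℝ) ≤ Nat.card F := by exact_mod_cast Finite.one_lt_card
  have hx0 : 0 < x := by rw [hx]; positivity
  have hx1 : x ≤ 1 / 2 := by
    rw [hx, one_div]
    exact inv_anti₀ (by norm_num) hq
  obtain ⟨r, rfl⟩ := hd
  obtain ⟨r, rfl⟩ : ∃ s, r = s + 1 := Nat.exists_eq_succ_of_ne_zero (by rintro rfl; simp at hm0)
  have h := noncyclicPrimaryCard_div_glCard_le hm hi (X := x ^ g.natDegree)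
    (by rw [hx, inv_pow]) r
  rw [mul_comm g.natDegree]
  refine h.trans ((pow_div_prod_sub_le (by positivity) ?_ r).trans (le_of_eq ?_))
  · exact (pow_le_of_le_one hx0.le (by linarith) hi.natDegree_pos.ne').trans hx1
  · congr 1
    rw [← pow_mul]
    congr 1
    ring

theorem noncyclicPrimaryTotal_one_le :
    (noncyclicPrimaryTotal F 1 : ℝ) / glCard F 1 ≤ 0 := by
  refine (noncyclicPrimaryTotal_div_le F 1 (fun _ => 0) ?_ (fun _ => le_rfl) one_ne_zero).trans
    (by simp)
  intro g hm hi hd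
  have h1 := noncyclicPrimaryCard_self_nonpos hm hi
  rwa [Nat.dvd_one.1 hd] at h1

/-- Only linear g contribute. The case m = 2 is treated separately because the general bound of
`noncyclicPrimaryTotal_le` would be too large for `rate_inequality` at x = 1/3. -/
theorem noncyclicPrimaryTotal_two_le {x : ℝ} (hx : x = (Nat.card F : ℝ)⁻¹) :
    (noncyclicPrimaryTotal F 2 : ℝ) / glCard F 2 ≤ x ^ 3 / ((1 - x) * (1 - x ^ 2)) := by
  have hq : (1 : ℝ) < Nat.card F := by exact_mod_cast Finite.one_lt_card
  have hx0 : 0 < x := by rw [hx]; positivity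
  have hx1 : x < 1 := by rw [hx]; exact inv_lt_one_of_one_lt₀ hq
  have h2 : 0 < 1 - x ^ 2 := by nlinarith
  have h1 : 0 < 1 - x := by linarith
  have hqx : (Nat.card F : ℝ) * x = 1 := by rw [hx]; exact mul_inv_cancel₀ (by linarith)
  refine (noncyclicPrimaryTotal_div_le F 2
    (fun d => if d = 1 then x ^ 4 / ((1 - x) * (1 - x ^ 2)) else 0) ?_ ?_ two_ne_zero).trans ?_
  · intro g hm hi hd
    rcases (Nat.dvd_prime Nat.prime_two).1 hd with h | h
    · rw [if_pos h]
      exact noncyclicPrimaryCard_two_le hm hi hx h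
    · rw [if_neg (by omega)]
      have h3 := noncyclicPrimaryCard_self_nonpos hm hi
      rwa [h] at h3
  · intro d
    split_ifs
    · positivity
    · exact le_rfl
  · rw [Nat.Prime.divisors Nat.prime_two, Finset.sum_pair (by norm_num)]
    simp only [if_true, pow_one]
    norm_num
    refine le_of_eq ?_
    calc (Nat.card F : ℝ) * (x ^ 4 / ((1 - x) * (1 - x ^ 2)))
        = (Nat.card F * x) * (x ^ 3 / ((1 - x) * (1 - x ^ 2))) := by ring
      _ = _ := by rw [hqx, one_mul]

theorem noncyclicPrimaryTotal_le {x : ℝ} (hx : x = (Nat.card F : ℝ)⁻¹) (hx3 : x ≤ 1 / 3)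
    {m : ℕ} (hm : 2 ≤ m) :
    (noncyclicPrimaryTotal F m : ℝ) / glCard F m ≤
      (1 / ((1 - x) * (1 - x - x ^ 2)) + 13 / 10 * x / (1 - x)) * x ^ (m + 1) := by
  have hq : (1 : ℝ) < Nat.card F := by exact_mod_cast Finite.one_lt_card
  have hx0 : 0 < x := by rw [hx]; positivity
  have h1 : 0 < 1 - x := by linarith
  have h2 : 0 < 1 - x - x ^ 2 := by nlinarith
  have hqx : (Nat.card F : ℝ) * x = 1 := by rw [hx]; exact mul_inv_cancel₀ (by linarith)
  refine (noncyclicPrimaryTotal_div_le F m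
    (fun d => if d = 1 then x ^ (m + 2) / ((1 - x) * (1 - x - x ^ 2)) else
      13 / 10 * x ^ (m + 2 * d)) ?_ ?_ (by omega)).trans ?_
  · intro g hmo hi hd
    have h3 := noncyclicPrimaryCard_le hmo hi hx (by omega) hd
    split_ifs with h
    · rwa [h, pow_one, mul_one] at h3
    · refine h3.trans ?_
      have hpos := hi.natDegree_pos
      have h4 : x ^ g.natDegree ≤ 1 / 9 := by
        calc x ^ g.natDegree ≤ x ^ 2 := pow_le_pow_of_le_one hx0.le (by linarith) (by omega)
          _ ≤ (1 / 3) ^ 2 := by gcongr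
          _ = 1 / 9 := by norm_num
      have h5 : 0 < x ^ g.natDegree := by positivity
      set X := x ^ g.natDegree
      -- At X = 1/9 the product is 568/729 > 10/13; this is the source of the factor 13/10 for
      -- degrees at least 2.
      have h6 : 10 / 13 ≤ (1 - X) * (1 - X - X ^ 2) := by nlinarith
      rw [div_le_iff₀ (by linarith)]
      have h7 : 0 < x ^ (m + 2 * g.natDegree) := by positivity
      nlinarith
  · intro d
    split_ifs <;> positivity
  -- Degree 1 gives the main term; the other divisors are enlarged to all of 2, ..., m, giving a
  -- geometric series.
  · have hsub : m.divisors ⊆ insert 1 (Finset.Icc 2 m) := by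
      intro d hd
      have := Nat.pos_of_mem_divisors hd
      have := Nat.divisor_le hd
      rw [Finset.mem_insert, Finset.mem_Icc]
      omega
    refine (Finset.sum_le_sum_of_subset_of_nonneg hsub fun d _ _ => ?_).trans ?_
    · split_ifs <;> positivity
    rw [Finset.sum_insert (by simp), if_pos rfl, pow_one]
    have h3 : ∑ d ∈ Finset.Icc 2 m, (Nat.card F : ℝ) ^ d * (if d = 1 then
        x ^ (m + 2) / ((1 - x) * (1 - x - x ^ 2)) else 13 / 10 * x ^ (m + 2 * d)) =
        13 / 10 * x ^ m * ∑ d ∈ Finset.Icc 2 m, x ^ d := by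
      rw [Finset.mul_sum]
      refine Finset.sum_congr rfl fun d hd => ?_
      rw [if_neg (by have := (Finset.mem_Icc.1 hd).1; omega)]
      calc (Nat.card F : ℝ) ^ d * (13 / 10 * x ^ (m + 2 * d))
          = (Nat.card F * x) ^ d * (13 / 10 * x ^ m * x ^ d) := by
            rw [mul_pow, pow_add, pow_mul', sq]; ring
        _ = _ := by rw [hqx, one_pow, one_mul]
    rw [h3]
    have h4 := mul_le_mul_of_nonneg_left (sum_Icc_two_pow_le hx0.le (by linarith) m)
      (show 0 ≤ 13 / 10 * x ^ m by positivity)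
    have h5 : (Nat.card F : ℝ) * (x ^ (m + 2) / ((1 - x) * (1 - x - x ^ 2))) =
        1 / ((1 - x) * (1 - x - x ^ 2)) * x ^ (m + 1) := by
      calc (Nat.card F : ℝ) * (x ^ (m + 2) / ((1 - x) * (1 - x - x ^ 2)))
          = (Nat.card F * x) * (1 / ((1 - x) * (1 - x - x ^ 2)) * x ^ (m + 1)) := by ring
        _ = _ := by rw [hqx, one_mul]
    rw [h5, add_mul]
    refine add_le_add_right (h4.trans (le_of_eq ?_)) _
    field_simp
    ring

end Density

/-! ### Exponential decay from the renewal inequality -/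

section Numerics

/-- This is hypothesis `hrate` of `lt_of_renewal`. To first order the two sides are 1 + (19/10) x
and 1 + 2x, so 12/5 leaves a margin of x/10. -/
theorem rate_inequality {x : ℝ} (hx : 0 < x) (hx3 : x ≤ 1 / 3) :
    x / ((1 - x) * (1 - x ^ 2)) +
      (1 / ((1 - x) * (1 - x - x ^ 2)) + 13 / 10 * x / (1 - x)) / (1 + 12 / 5 * x) ≤
      (1 + x + 12 / 5 * x ^ 2) ^ 2 := by
  have h1 : 0 < 1 - x := by linarith
  have h2 : 0 < 1 - x ^ 2 := by nlinarith
  have h3 : 0 < 1 - x - x ^ 2 := by nlinarith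
  have h4 : 0 < 1 + 12 / 5 * x := by linarith
  have h1' := h1.ne'
  have h2' := h2.ne'
  have h3' := h3.ne'
  have h4' := h4.ne'
  -- The numerator is grouped so that each bracket is nonnegative for 0 < x ≤ 1/3.
  have key : (1 + x + 12 / 5 * x ^ 2) ^ 2 - (x / ((1 - x) * (1 - x ^ 2)) +
      (1 / ((1 - x) * (1 - x - x ^ 2)) + 13 / 10 * x / (1 - x)) / (1 + 12 / 5 * x)) =
      x * (1 / 10 + x * (17 / 10 + 53 / 25 * x - 823 / 50 * x ^ 2 - 2489 / 250 * x ^ 3) +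
        x ^ 5 * (854 / 125 + 3427 / 125 * x + 2844 / 125 * x ^ 2 - 432 / 25 * x ^ 3 -
          1728 / 125 * x ^ 4)) /
      ((1 - x) * (1 - x ^ 2) * (1 - x - x ^ 2) * (1 + 12 / 5 * x)) := by
    rw [eq_div_iff (by positivity)]
    field_simp
    ring
  rw [← sub_nonneg, key]
  have hx2 : x ^ 2 ≤ 1 / 3 * x := by nlinarith
  have hx3 : x ^ 3 ≤ 1 / 3 * x ^ 2 := by nlinarith [sq_nonneg x]
  have hx4 : x ^ 4 ≤ 1 / 3 * x ^ 3 := by nlinarith [pow_pos hx 3]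
  have h5 : 0 ≤ 17 / 10 + 53 / 25 * x - 823 / 50 * x ^ 2 - 2489 / 250 * x ^ 3 := by linarith
  have h6 : 0 ≤ 854 / 125 + 3427 / 125 * x + 2844 / 125 * x ^ 2 - 432 / 25 * x ^ 3 -
      1728 / 125 * x ^ 4 := by linarith [sq_nonneg x]
  positivity

theorem sum_Icc_pow_sub {ρ : ℝ} (hρ : ρ ≠ 1) (n : ℕ) :
    ∑ m ∈ Finset.Icc 3 (n + 2), ρ ^ (n + 3 - m) = (ρ ^ (n + 1) - ρ) / (ρ - 1) := by
  have h : ρ - 1 ≠ 0 := sub_ne_zero.2 hρ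
  rw [eq_div_iff h]
  induction n with
  | zero => simp
  | succ n ih =>
    have h1 : ∑ m ∈ Finset.Icc 3 (n + 1 + 2), ρ ^ (n + 1 + 3 - m) =
        ρ * ∑ m ∈ Finset.Icc 3 (n + 2), ρ ^ (n + 3 - m) + ρ := by
      rw [Finset.sum_Icc_succ_top (by omega), Finset.mul_sum]
      congr 1
      · refine Finset.sum_congr rfl fun m hm => ?_
        have := (Finset.mem_Icc.1 hm).2
        rw [← pow_succ']
        congr 1
        omega
      · rw [show n + 1 + 3 - (n + 1 + 2) = 1 by omega, pow_one]
    rw [h1, add_mul, mul_assoc, ih]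
    ring

/-- Exponential decay for a sequence satisfying a renewal-type inequality. -/
theorem lt_of_renewal {x c₂ c k ρ : ℝ} (hx : 0 < x) (hc₂ : 0 ≤ c₂) (hc : 0 < c) (hk : 0 < k)
    (hρ : 0 < ρ) {y : ℝ} (hy : 0 < y) (hρy : ρ - 1 = x * y)
    (hrate : c₂ * x + c / y ≤ ρ ^ 2) (hky : y < k * ρ) (hk2 : c₂ < k * ρ ^ 2)
    {A U : ℕ → ℝ} (hA0 : ∀ m, 0 ≤ A m) (hU0 : U 0 ≤ 1) (hUn : ∀ n, 0 ≤ U n)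
    (hU : ∀ n, 1 ≤ n → U n ≤ ∑ m ∈ Finset.Icc 1 n, A m * U (n - m))
    (hA1 : A 1 ≤ 0) (hA2 : A 2 ≤ c₂ * x ^ 3) (hA : ∀ m, 2 ≤ m → A m ≤ c * x ^ (m + 1))
    (n : ℕ) (hn : 1 ≤ n) : U n < k * x * (x * ρ) ^ n := by
  induction n using Nat.strong_induction_on with
  | _ n ih =>
    have h1 := hU n hn
    have hA1' : A 1 = 0 := le_antisymm hA1 (hA0 1)
    rcases Nat.lt_or_ge n 3 with h | h
    · interval_cases n
      · simp [hA1'] at h1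
        exact h1.trans_lt (by positivity)
      · rw [Finset.sum_Icc_succ_top (by norm_num)] at h1
        simp [hA1'] at h1
        have h2 : A 2 * U 0 ≤ c₂ * x ^ 3 :=
          (mul_le_of_le_one_right (hA0 2) hU0).trans hA2
        have h3 : c₂ * x ^ 3 < k * ρ ^ 2 * x ^ 3 := by gcongr
        calc U 2 ≤ A 2 * U 0 := h1
          _ ≤ _ := h2
          _ < _ := h3
          _ = _ := by ring
    · obtain ⟨n, rfl⟩ : ∃ l, n = l + 3 := ⟨n - 3, by omega⟩
      -- The term m = 1 vanishes, m = 2 has its own constant, and m = n + 3 is isolated because the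
      -- inductive bound does not cover U 0.
      have h2 : ∑ m ∈ Finset.Icc 1 (n + 3), A m * U (n + 3 - m) =
          A 2 * U (n + 1) + ∑ m ∈ Finset.Icc 3 (n + 2), A m * U (n + 3 - m) +
            A (n + 3) * U 0 := by
        rw [Finset.sum_Icc_succ_top (by omega), ← Finset.add_sum_Ioc_eq_sum_Icc (by omega),
          ← Finset.Icc_succ_left_eq_Ioc, ← Finset.add_sum_Ioc_eq_sum_Icc (a := Order.succ 1) (by simp),
          ← Finset.Icc_succ_left_eq_Ioc, hA1']
        simp
      have h3 : A 2 * U (n + 1) ≤ c₂ * x ^ 3 * (k * x * (x * ρ) ^ (n + 1)) :=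
        mul_le_mul hA2 (ih (n + 1) (by omega) (by omega)).le (hUn _) (by positivity)
      have h4 : ∑ m ∈ Finset.Icc 3 (n + 2), A m * U (n + 3 - m) ≤
          c * k * x ^ (n + 5) * ((ρ ^ (n + 1) - ρ) / (ρ - 1)) := by
        rw [← sum_Icc_pow_sub (by nlinarith), Finset.mul_sum]
        refine Finset.sum_le_sum fun m hm => ?_
        obtain ⟨hm1, hm2⟩ := Finset.mem_Icc.1 hm
        refine (mul_le_mul (hA m (by omega)) (ih (n + 3 - m) (by omega) (by omega)).le (hUn _)
          (by positivity)).trans (le_of_eq ?_)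
        obtain ⟨j, hj⟩ : ∃ j, n + 3 = m + j := ⟨n + 3 - m, by omega⟩
        have h5 : n + 5 = m + j + 2 := by omega
        rw [h5, show n + 3 - m = j by omega]
        ring
      have h5 : A (n + 3) * U 0 ≤ c * x ^ (n + 4) :=
        (mul_le_of_le_one_right (hA0 _) hU0).trans (hA (n + 3) (by omega))
      have h6 : c₂ * x ^ 3 * (k * x * (x * ρ) ^ (n + 1)) +
          c * k * x ^ (n + 5) * ((ρ ^ (n + 1) - ρ) / (ρ - 1)) + c * x ^ (n + 4) =
          x ^ (n + 4) * (k * ρ ^ (n + 1) * (c₂ * x + c / y) + c * (1 - k * ρ / y)) := by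
        rw [hρy]
        field_simp
        ring
      -- The U 0 term is absorbed by the lower endpoint -ρ of the geometric sum; this is where y <
      -- kρ is needed.
      have h7 : 1 - k * ρ / y < 0 := by
        rw [sub_neg, lt_div_iff₀ hy, one_mul]
        exact hky
      have h8 : k * ρ ^ (n + 1) * (c₂ * x + c / y) ≤ k * ρ ^ (n + 1) * ρ ^ 2 := by gcongr
      calc U (n + 3) ≤ _ := h1
        _ ≤ x ^ (n + 4) * (k * ρ ^ (n + 1) * (c₂ * x + c / y) + c * (1 - k * ρ / y)) := by
          rw [h2, ← h6]; linarith
        _ < x ^ (n + 4) * (k * ρ ^ (n + 1) * ρ ^ 2) := by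
          have : c * (1 - k * ρ / y) < 0 := mul_neg_of_pos_of_neg hc h7
          gcongr
          linarith
        _ = _ := by ring

variable (F : Type*) [Field F] [Finite F]

theorem uncyclicCard_div_lt (hq : 3 ≤ Nat.card F) {x : ℝ} (hx : x = (Nat.card F : ℝ)⁻¹) {n : ℕ}
    (hn : 1 ≤ n) : (uncyclicCard F n : ℝ) / glCard F n <
      (1 + 3 / 2 * x + 2 / 3 * x ^ 2) * x * (x + x ^ 2 + 12 / 5 * x ^ 3) ^ n := by
  have hq' : (3 : ℝ) ≤ Nat.card F := by exact_mod_cast hq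
  have hx0 : 0 < x := by rw [hx]; positivity
  have hx3 : x ≤ 1 / 3 := by
    rw [hx, one_div]
    exact inv_anti₀ (by norm_num) hq'
  have h1 : 0 < 1 - x := by linarith
  have h2 : 0 < 1 - x ^ 2 := by nlinarith
  have h3 : 0 < 1 - x - x ^ 2 := by nlinarith
  have hρ : x + x ^ 2 + 12 / 5 * x ^ 3 = x * (1 + x + 12 / 5 * x ^ 2) := by ring
  rw [hρ]
  -- Here ρ = 1 + x + (12/5) x², and y is forced by ρ - 1 = x y.
  refine lt_of_renewal (c₂ := 1 / ((1 - x) * (1 - x ^ 2)))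
    (c := 1 / ((1 - x) * (1 - x - x ^ 2)) + 13 / 10 * x / (1 - x)) (y := 1 + 12 / 5 * x)
    (A := fun m => (noncyclicPrimaryTotal F m : ℝ) / glCard F m)
    (U := fun m => (uncyclicCard F m : ℝ) / glCard F m)
    hx0 (by positivity) (by positivity) (by positivity) (by positivity) (by positivity) (by ring)
    ?_ ?_ ?_ (fun m => by positivity) ?_ (fun m => by positivity)
    (fun n hn => uncyclicCard_div_le hn) noncyclicPrimaryTotal_one_le ?_
    (fun m hm => noncyclicPrimaryTotal_le hx hx3 hm) n hn
  · have := rate_inequality hx0 hx3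
    rwa [one_div_mul_eq_div]
  · nlinarith [pow_pos hx0 3, pow_pos hx0 2, pow_pos hx0 4]
  · rw [div_lt_iff₀ (by positivity)]
    have h4 : 8 / 9 * (1 - x) ≤ (1 - x) * (1 - x ^ 2) := by
      have h6 : 8 / 9 ≤ 1 - x ^ 2 := by nlinarith
      nlinarith
    have h5 : (1 + 3 / 2 * x) * (1 + 2 * x) ≤
        (1 + 3 / 2 * x + 2 / 3 * x ^ 2) * (1 + x + 12 / 5 * x ^ 2) ^ 2 := by
      have h6 : 1 + 2 * x ≤ (1 + x + 12 / 5 * x ^ 2) ^ 2 := by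
        nlinarith [pow_pos hx0 3, pow_pos hx0 2, pow_pos hx0 4]
      exact mul_le_mul (by nlinarith) h6 (by positivity) (by positivity)
    have h7 : 1 < (1 + 3 / 2 * x) * (1 + 2 * x) * ((1 - x) * (1 - x ^ 2)) := by
      nlinarith [pow_pos hx0 3, pow_pos hx0 2, pow_pos hx0 4, pow_pos hx0 5, mul_pos hx0 h1]
    exact h7.trans_le (mul_le_mul_of_nonneg_right h5 (by positivity))
  · have : uncyclicCard F 0 ≤ 1 := by
      refine Finite.card_le_one_iff_subsingleton.2 ⟨fun a b => ?_⟩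
      ext x i
      exact i.elim0
    simp only [glCard_zero]
    simpa using this
  · refine (noncyclicPrimaryTotal_two_le hx).trans (le_of_eq ?_)
    ring

end Numerics

/-! ### From f-cyclic matrices to uncyclic endomorphisms -/

section FCyclic

variable {F : Type*} [Field F]

theorem finrank_ker_mul_le {V : Type*} [AddCommGroup V] [Module F V] [FiniteDimensional F V]
    (a b : End F V) : finrank F (LinearMap.ker (b * a)) ≤
      finrank F (LinearMap.ker b) + finrank F (LinearMap.ker a) := by
  have h := LinearMap.finrank_range_add_finrank_ker (a.domRestrict (LinearMap.ker (b * a)))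
  rw [← h]
  refine add_le_add (Submodule.finrank_mono ?_) ?_
  · rintro _ ⟨x, rfl⟩
    exact x.2
  · refine LinearMap.finrank_le_finrank_of_injective
      (f := ((LinearMap.ker (b * a)).subtype ∘ₗ Submodule.subtype _).codRestrict _ fun x => x.2) ?_
    intro x y hxy
    have h1 : (x.1.1 : V) = y.1.1 := congrArg (fun z : LinearMap.ker a => (z : V)) hxy
    exact Subtype.ext (Subtype.ext h1)

theorem finrank_ker_aeval_pow_le {V : Type*} [AddCommGroup V] [Module F V] [FiniteDimensional F V]
    (f : End F V) (g : F[X]) (N : ℕ) : finrank F (LinearMap.ker (aeval f (g ^ N))) ≤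
      N * finrank F (LinearMap.ker (aeval f g)) := by
  induction N with
  | zero =>
    have : LinearMap.ker (aeval f (g ^ 0)) = ⊥ := by simp [Module.End.one_eq_id]
    rw [this, finrank_bot]
    exact Nat.zero_le _
  | succ N ih =>
    rw [pow_succ, map_mul, Nat.add_mul, one_mul]
    exact (finrank_ker_mul_le _ _).trans (Nat.add_le_add_right ih _)

/-- The kernel of g^N has dimension at most N deg g, which is the dimension of the orbit of a vector
with annihilator exactly g^N. So such a vector generates; if there is none, the kernels of g^N and
g^(N-1) agree and induction applies. -/
theorem isPrincipal_torsionBy_of_finrank_ker_le {V : Type*} [AddCommGroup V] [Module F V]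
    [FiniteDimensional F V] {f : End F V} {g : F[X]} (hm : g.Monic) (hi : Irreducible g)
    (hk : finrank F (LinearMap.ker (aeval f g)) ≤ g.natDegree) (N : ℕ) :
    (Submodule.torsionBy F[X] (AEval' f) (g ^ N)).IsPrincipal := by
  have hmem : ∀ (p : F[X]) (v : V), AEval'.of f v ∈ Submodule.torsionBy F[X] (AEval' f) p ↔
      aeval f p v = 0 := by
    intro p v
    rw [Submodule.mem_torsionBy_iff]
    exact Iff.rfl
  induction N with
  | zero =>
    refine ⟨0, ?_⟩
    rw [pow_zero, Submodule.torsionBy_one, Submodule.span_zero_singleton]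
  | succ N ih =>
    by_cases h : ∃ v, aeval f (g ^ (N + 1)) v = 0 ∧ aeval f (g ^ N) v ≠ 0
    · obtain ⟨v, hv, hv'⟩ := h
      have hp := hm.pow (N + 1)
      have : Module.Finite F (AdjoinRoot (g ^ (N + 1))) := hp.finite_adjoinRoot
      have hle : LinearMap.range (orbitMap hp f v) ≤ LinearMap.ker (aeval f (g ^ (N + 1))) := by
        rintro _ ⟨x, rfl⟩
        obtain ⟨s, rfl⟩ := AdjoinRoot.mk_surjective x
        rw [LinearMap.mem_ker, orbitMap_mk hp hv, ← Module.End.mul_apply, ← map_mul, mul_comm,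
          map_mul, Module.End.mul_apply, hv, map_zero]
      have heq := Submodule.eq_of_le_of_finrank_le hle (by
        rw [LinearMap.finrank_range_of_inj (orbitMap_injective hi hp hv hv'),
          finrank_adjoinRoot hp.ne_zero, natDegree_pow]
        exact (finrank_ker_aeval_pow_le f g (N + 1)).trans (Nat.mul_le_mul_left _ hk))
      refine ⟨AEval'.of f v, le_antisymm (fun w hw => ?_) ?_⟩
      · obtain ⟨w, rfl⟩ := (AEval'.of f).surjective w
        rw [hmem, ← LinearMap.mem_ker, ← heq] at hw
        obtain ⟨x, hx⟩ := hw
        obtain ⟨s, rfl⟩ := AdjoinRoot.mk_surjective x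
        rw [orbitMap_mk hp hv] at hx
        refine Submodule.mem_span_singleton.2 ⟨s, ?_⟩
        rw [← hx]
        rfl
      · rw [Submodule.span_singleton_le_iff_mem, hmem]
        exact hv
    · push Not at h
      have : Submodule.torsionBy F[X] (AEval' f) (g ^ (N + 1)) =
          Submodule.torsionBy F[X] (AEval' f) (g ^ N) := by
        refine le_antisymm (fun w hw => ?_) ?_
        · obtain ⟨w, rfl⟩ := (AEval'.of f).surjective w
          rw [hmem] at hw ⊢
          exact h w hw
        · exact Submodule.torsionBy_le_torsionBy_of_dvd _ _ (pow_dvd_pow g (Nat.le_succ N))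
      rw [this]
      exact ih

theorem charpoly_vecMulLinear {n : ℕ} (X : Matrix (Fin n) (Fin n) F) :
    X.vecMulLinear.charpoly = X.charpoly := by
  rw [← Matrix.mulVecLin_transpose, Matrix.charpoly_mulVecLin, Matrix.charpoly_transpose]

theorem isUncyclic_vecMulLinear {n : ℕ} {X : Matrix (Fin n) (Fin n) F} (hX : ¬ IsFCyclic X) :
    IsUncyclic X.vecMulLinear := by
  intro g hm hi hker
  by_contra hle
  refine hX ⟨g, hm, hi, ?_, isPrincipal_torsionBy_of_finrank_ker_le hm hi (not_lt.1 hle) _⟩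
  -- By Cayley–Hamilton and Bézout, g(X) is injective unless g divides the characteristic
  -- polynomial.
  by_contra hdvd
  obtain ⟨a, b, hab⟩ := hi.coprime_iff_not_dvd.2 hdvd
  refine hker (eq_bot_iff.2 fun x hx => ?_)
  have h1 : aeval X.vecMulLinear X.charpoly = 0 := by
    rw [← charpoly_vecMulLinear]
    exact LinearMap.aeval_self_charpoly _
  have : aeval X.vecMulLinear (a * g + b * X.charpoly) x = 0 := by
    simp [h1, LinearMap.mem_ker.1 hx]
  simpa [hab] using this

theorem one_sub_fCyclicProb_le [Fintype F] (n : ℕ) :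
    1 - fCyclicProb F n ≤ (uncyclicCard F n : ℝ) / glCard F n := by
  classical
  have := finite_linearMap (F := F) (Fin n → F) (Fin n → F)
  let M := Matrix (Fin n) (Fin n) F
  have hM : (0 : ℝ) < Fintype.card M := by exact_mod_cast Fintype.card_pos
  have hp : fCyclicProb F n = (Fintype.card {X : M | IsFCyclic X} : ℝ) / Fintype.card M := by
    let _ : MeasurableSpace M := ⊤
    rw [fCyclicProb, MeasureTheory.measureReal_def,
      PMF.toMeasure_uniformOfFintype_apply _ MeasurableSpace.measurableSet_top]
    simp [ENNReal.toReal_div, M]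
  have hcompl : (Fintype.card {X : M | IsFCyclic X} : ℝ) +
      Fintype.card {X : M | ¬ IsFCyclic X} = Fintype.card M := by
    have h1 := Fintype.card_congr (Equiv.sumCompl fun X : M => IsFCyclic X)
    rw [Fintype.card_sum] at h1
    exact_mod_cast h1
  have hle : Fintype.card {X : M | ¬ IsFCyclic X} ≤ uncyclicCard F n := by
    rw [← Nat.card_eq_fintype_card]
    refine Nat.card_le_card_of_injective
      (fun X => ⟨X.1.vecMulLinear, isUncyclic_vecMulLinear X.2⟩) ?_
    intro X Y h
    have h1 := congrArg Subtype.val h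
    exact Subtype.ext (Matrix.toLinearMapRight'.injective h1)
  -- Replacing the denominator q^(n²) by the smaller |GL_n| only increases the quotient.
  have hgl : (glCard F n : ℝ) ≤ Fintype.card M := by
    have h1 := glCard_le (F := F) n
    rw [← card_end, ← Nat.card_congr (LinearMap.toMatrix' (R := F) (m := Fin n) (n := Fin n)).toEquiv.symm,
      Nat.card_eq_fintype_card] at h1
    exact_mod_cast h1
  have hpos : (0 : ℝ) < glCard F n := by exact_mod_cast glCard_pos n
  have h1 : 1 - fCyclicProb F n = (Fintype.card {X : M | ¬ IsFCyclic X} : ℝ) / Fintype.card M := by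
    rw [hp, eq_div_iff hM.ne', sub_mul, div_mul_cancel₀ _ hM.ne']
    linarith
  rw [h1]
  have : (Fintype.card {X : M | ¬ IsFCyclic X} : ℝ) ≤ uncyclicCard F n := by exact_mod_cast hle
  gcongr

end FCyclic

theorem mainTheorem6 {F : Type*} [Field F] [Fintype F] (n q : ℕ) (hn : 1 ≤ n) (hq : 3 ≤ q)
    (hF : Fintype.card F = q) :
    1 - (1 + 3 / 2 * (q : ℝ)⁻¹ + 2 / 3 * (q : ℝ)⁻¹ ^ 2) * (q : ℝ)⁻¹ *
        ((q : ℝ)⁻¹ + (q : ℝ)⁻¹ ^ 2 + 12 / 5 * (q : ℝ)⁻¹ ^ 3) ^ n < fCyclicProb F n ∧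
      fCyclicProb F n ≤ 1 := by
  have hF' : Nat.card F = q := by rw [Nat.card_eq_fintype_card, hF]
  constructor
  · have h1 := uncyclicCard_div_lt F (by rwa [hF']) (x := (q : ℝ)⁻¹) (by rw [hF']) hn
    have h2 := one_sub_fCyclicProb_le (F := F) n
    linarith
  · let _ : MeasurableSpace (Matrix (Fin n) (Fin n) F) := ⊤
    exact MeasureTheory.measureReal_le_one
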